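/- Let $T\subset\mathbb R$ be a time scale (a nonempty closed set) with $\sup T=\infty$, with forward jump operator $\sigma(t)=\inf\{s\in T: s>t\}$ and graininess $\mu(t)=\sigma(t)-t$. Let $A$ be a real $n\times n$-matrix-valued function on $T$ that is rd-continuous (continuous at right-dense points, with finite left-sided limits at left-dense points) and regressive ($I+\mu(t)A(t)$ is invertible for every $t\in T$). For an rd-continuous $f$ and $a,b\in T$ put $\int_a^b f(t)\,\Delta t=F(b)-F(a)$, where $F^\Delta=f$ on $T$; the integral $\int_a^\infty f(t)\,\Delta t=\lim_{b\to\infty,\ b\in T}\int_a^b f(t)\,\Delta t$ is called convergent if this limit exists and is finite, and absolutely convergent if $\int_a^\infty|f(t)|\,\Delta t$ is convergent. Let $a\in T$ and let $k\ge 1$ be an integer. Put $B_1(t)=A(t)$ and $$B_{j+1}(t)=A(t)\int_t^\infty B_j(s)\,\Delta s ,\qquad\text{i.e.}\qquad B_{j}(t_1)=A(t_1)\int_{t_1}^\infty A(t_2)\int_{t_2}^\infty\cdots\int_{t_{j-1}}^\infty A(t_{j})\,\Delta t_{j}\cdots\Delta t_2 .$$ Suppose that the iterated integrals $\int_a^\infty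 B_j(t)\,\Delta t$, $j=1,\dots,k$, are convergent (possibly only conditionally), and that the $(k+1)$-fold iterated integral $\int_a^\infty B_{k+1}(t)\,\Delta t$ is absolutely convergent, that is, $\int_a^\infty |B_{k+1}(t)|\,\Delta t<\infty$. Then the system $x^\Delta=A(t)x$, $t\in T$, is of class (S): (i) every solution $x(t)$ has a finite limit as $t\to\infty$, $t\in T$, and (ii) for every constant vector $x_\infty\in\mathbb R^n$ there is a solution $x(t)$ with $x(t)\to x_\infty$ as $t\to\infty$, $t\in T$. -/

import Mathlib

open Filter Topology
open scoped Matrix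

/- Matrices carry the operator norm subordinate to the sup norm on `Fin n → ℝ`
(the choice of matrix norm is immaterial, all of them being equivalent). -/
attribute [local instance] Matrix.linftyOpNormedAddCommGroup Matrix.linftyOpNormedSpace

/-! Calculus on a time scale `T`: a nonempty closed subset of `ℝ`, here always unbounded above, so
that the set `T^κ` on which delta derivatives are considered is all of `T`.  A function on `T` is
represented by a function on `ℝ` of which only the values on `T` are used. -/

namespace TimeScale

variable {E : Type*} [NormedAddCommGroup E] [NormedSpace ℝ E]

/-- The forward jump operator `σ(t) = inf {s ∈ T : s > t}`. -/
noncomputable def sigma (T : Set ℝ) (t : ℝ) : ℝ := sInf {s | s ∈ T ∧ t < s}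

/-- The graininess `μ(t) = σ(t) - t`. -/
noncomputable def graininess (T : Set ℝ) (t : ℝ) : ℝ := sigma T t - t

/-- The limit at infinity along the time scale: the filter of `t → ∞`, `t ∈ T`. -/
def atInfty (T : Set ℝ) : Filter ℝ := atTop ⊓ 𝓟 T

/-- `f` has the delta (Hilger) derivative `f'` at `t`: for every `ε > 0` there is a neighbourhood
of `t` in `T` on which `|f(σ(t)) - f(s) - f' (σ(t) - s)| ≤ ε |σ(t) - s|`. -/
def HasDeltaDerivAt (T : Set ℝ) (f : ℝ → E) (f' : E) (t : ℝ) : Prop :=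
  ∀ ε > 0, ∀ᶠ s in 𝓝[T] t,
    ‖f (sigma T t) - f s - (sigma T t - s) • f'‖ ≤ ε * |sigma T t - s|

/-- `f` is rd-continuous: continuous at the right-dense points of `T`, with finite left-sided
limits at the left-dense points (at a point of `T` that is not left-dense the filter below is
trivial, and nothing is required). -/
def RdContinuous (T : Set ℝ) (f : ℝ → E) : Prop :=
  (∀ t ∈ T, sigma T t = t → ContinuousWithinAt f T t) ∧
  (∀ t ∈ T, ∃ l : E, Tendsto f (𝓝[T ∩ Set.Iio t] t) (𝓝 l))

/-- `F` is a delta antiderivative of `f` on `T`. -/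
def IsAntideriv (T : Set ℝ) (F f : ℝ → E) : Prop :=
  ∀ t ∈ T, HasDeltaDerivAt T F (f t) t

open Classical in
/-- The Cauchy delta integral `∫_a^b f(t) Δt = F(b) - F(a)` for `a, b ∈ T`, where `F` is any
antiderivative of `f` (rd-continuous functions have one, unique on `T` up to a constant);
the value is `0` if there is no antiderivative. -/
noncomputable def integral (T : Set ℝ) (f : ℝ → E) (a b : ℝ) : E :=
  if h : ∃ F : ℝ → E, IsAntideriv T F f then h.choose b - h.choose a else 0

/-- The improper integral `∫_a^∞ f(t) Δt` is convergent. -/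
def Convergent (T : Set ℝ) (f : ℝ → E) (a : ℝ) : Prop :=
  ∃ v : E, Tendsto (fun b => integral T f a b) (atInfty T) (𝓝 v)

/-- The integral `∫_a^∞ f(t) Δt` is convergent absolutely: `∫_a^∞ |f(t)| Δt` is convergent. -/
def AbsConvergent (T : Set ℝ) (f : ℝ → E) (a : ℝ) : Prop :=
  Convergent T (fun t => ‖f t‖) a

/-- The value `∫_a^∞ f(t) Δt = lim_{b → ∞, b ∈ T} ∫_a^b f(t) Δt` (meaningful when convergent). -/
noncomputable def improperIntegral (T : Set ℝ) (f : ℝ → E) (a : ℝ) : E :=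
  limUnder (atInfty T) (fun b => integral T f a b)

variable {n : ℕ}

/-- The integrand (a function of `t₁`) of the `(j+1)`-fold iterated integral:
`A(t₁) ∫_{t₁}^∞ A(t₂) ∫_{t₂}^∞ ⋯ ∫_{t_j}^∞ A(t_{j+1}) Δt_{j+1} ⋯ Δt₂`. -/
noncomputable def iterIntegrand (T : Set ℝ) (A : ℝ → Matrix (Fin n) (Fin n) ℝ) :
    ℕ → ℝ → Matrix (Fin n) (Fin n) ℝ
  | 0 => A
  | j + 1 => fun t => A t * improperIntegral T (iterIntegrand T A j) t

/-- `A` is regressive: `I + μ(t) A(t)` is invertible for all `t ∈ T`. -/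
def Regressive (T : Set ℝ) (A : ℝ → Matrix (Fin n) (Fin n) ℝ) : Prop :=
  ∀ t ∈ T, IsUnit (1 + graininess T t • A t)

/-- `x` is a solution of `x^Δ = A(t) x` on `T`. -/
def IsSolution (T : Set ℝ) (A : ℝ → Matrix (Fin n) (Fin n) ℝ) (x : ℝ → Fin n → ℝ) : Prop :=
  ∀ t ∈ T, HasDeltaDerivAt T x (A t *ᵥ x t) t

/-- The system `x^Δ = A(t) x` is of class (S): every solution has a limit as `t → ∞`, and every
constant vector is the limit of some solution. -/
def IsClassS (T : Set ℝ) (A : ℝ → Matrix (Fin n) (Fin n) ℝ) : Prop :=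
  (∀ x : ℝ → Fin n → ℝ, IsSolution T A x →
    ∃ xinf : Fin n → ℝ, Tendsto x (atInfty T) (𝓝 xinf)) ∧
  (∀ xinf : Fin n → ℝ, ∃ x : ℝ → Fin n → ℝ,
    IsSolution T A x ∧ Tendsto x (atInfty T) (𝓝 xinf))

end TimeScale

/-!
Let `C j (t)` be the iterated improper integral of order `j` from `t` to `∞`, with `C 0 = 1`, so
that `C (j + 1)^Δ = - A C j` and `C j → 0` for `1 ≤ j ≤ k`. The alternating sum
`P = ∑_{j ≤ k} (-1)^j C j` is a truncated formal solution of `x^Δ = A x` with limit `1`: it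
satisfies `P^Δ = A P ∓ A C k`, and the error is, up to sign, the integrand `B = A C k` of the
iterated integral assumed to converge absolutely (`exists_approx_solution`). If `Φ` is an invertible fundamental
matrix, then for large `t` the quotient `Z = P⁻¹ Φ` solves `Z^Δ = D Z` with `D = ± (P^σ)⁻¹ B`, an
absolutely integrable coefficient (`exists_isUnit_tendsto_of_approx`). Normalised to be `1` at a
time after which `∫ ‖D‖` is small, `Z` remains bounded and close to `1`, hence is Cauchy with an
invertible limit (`exists_isUnit_tendsto_of_norm_le`). So `Φ = P Z` has an invertible limit, and
class (S) follows, because the solutions are the functions `Φ(t) c`.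

The calculus behind this rests on three facts. The mean value inequality
(`norm_sub_le_of_hasDeltaDerivAt`) makes antiderivatives unique and bounds increments. A right-dense
continuous function has an antiderivative (`RdContinuous.isAntideriv_integral`), namely the Lebesgue
integral of its extension by constants across the gaps of the time scale; right-continuity makes
that extension measurable. The fundamental matrix exists on all of `T` (`exists_fundamental`): to
the right of a starting point it is the sum of a Peano–Baker series, regressivity provides its
inverse as the solution of the adjoint equation, and inverses give the continuation to the left.

Everything except the last step is done in a Banach algebra `R` in place of the matrices; only the
invertibility of the fundamental solution uses that one-sided inverses in `R` are two-sided.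
-/

namespace TimeScale

/-! ### Order properties of a time scale -/

section Order

variable {T : Set ℝ}

lemma le_sigma (hsup : ¬ BddAbove T) (t : ℝ) : t ≤ sigma T t := by
  obtain ⟨s, hs, hts⟩ := not_bddAbove_iff.1 hsup t
  exact le_csInf ⟨s, hs, hts⟩ fun s hs => hs.2.le

lemma sigma_le {s t : ℝ} (hs : s ∈ T) (h : t < s) : sigma T t ≤ s :=
  csInf_le ⟨t, fun _ h => h.2.le⟩ ⟨hs, h⟩

lemma sigma_mem (hT : IsClosed T) (hsup : ¬ BddAbove T) (t : ℝ) : sigma T t ∈ T := by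
  obtain ⟨s, hs, hts⟩ := not_bddAbove_iff.1 hsup t
  have h := csInf_mem_closure (s := {s | s ∈ T ∧ t < s}) ⟨s, hs, hts⟩ ⟨t, fun _ h => h.2.le⟩
  exact hT.closure_subset (closure_mono (fun _ h => h.1) h)

lemma notMem_of_lt_sigma {s t : ℝ} (h : t < s) (h' : s < sigma T t) : s ∉ T :=
  fun hs => (sigma_le hs h).not_gt h'

lemma exists_mem_Ioo_of_rightDense (hsup : ¬ BddAbove T) {t b : ℝ} (h : sigma T t = t)
    (hb : t < b) : ∃ s ∈ T, t < s ∧ s < b := by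
  obtain ⟨s, hs, hts⟩ := not_bddAbove_iff.1 hsup t
  obtain ⟨u, hu, hub⟩ := exists_lt_of_csInf_lt (s := {s | s ∈ T ∧ t < s}) ⟨s, hs, hts⟩
    (show sInf {s | s ∈ T ∧ t < s} < b from (h.trans_lt hb))
  exact ⟨u, hu.1, hu.2, hub⟩

lemma exists_mem_ge (hsup : ¬ BddAbove T) (b : ℝ) : ∃ t ∈ T, b ≤ t := by
  obtain ⟨s, hs, hts⟩ := not_bddAbove_iff.1 hsup b
  exact ⟨s, hs, hts.le⟩

lemma atInfty_neBot (hsup : ¬ BddAbove T) : (atInfty T).NeBot := by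
  rw [atInfty, inf_principal_neBot_iff]
  intro U hU
  obtain ⟨b, hb⟩ := mem_atTop_sets.1 hU
  obtain ⟨t, ht, hbt⟩ := exists_mem_ge hsup b
  exact ⟨t, hb t hbt, ht⟩

lemma eventually_mem_atInfty : ∀ᶠ t in atInfty T, t ∈ T :=
  mem_inf_of_right (mem_principal_self T)

lemma eventually_ge_atInfty (b : ℝ) : ∀ᶠ t in atInfty T, b ≤ t :=
  mem_inf_of_left (eventually_ge_atTop b)

lemma eventually_atInfty {p : ℝ → Prop} (hsup : ¬ BddAbove T) :
    (∀ᶠ t in atInfty T, p t) ↔ ∃ b ∈ T, ∀ t ∈ T, b ≤ t → p t := by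
  constructor
  · intro h
    rw [atInfty, eventually_inf_principal, eventually_atTop] at h
    obtain ⟨b, hb⟩ := h
    obtain ⟨t, ht, hbt⟩ := exists_mem_ge hsup b
    exact ⟨t, ht, fun s hs hts => hb s (hbt.trans hts) hs⟩
  · rintro ⟨b, -, hb⟩
    filter_upwards [eventually_mem_atInfty, eventually_ge_atInfty b] with t h1 h2 using hb t h1 h2

/-- Near a right-scattered point the time scale lies on the left of the point. -/
lemma eventually_le_of_rightScattered {t : ℝ} (h : t < sigma T t) :
    ∀ᶠ s in 𝓝[T] t, s ≤ t := by
  filter_upwards [self_mem_nhdsWithin, mem_nhdsWithin_of_mem_nhds (Iio_mem_nhds h)] with s hs hs'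
  by_contra! hts
  exact notMem_of_lt_sigma hts hs' hs

lemma continuousWithinAt_sigma (hsup : ¬ BddAbove T) {t : ℝ} (h : sigma T t = t) :
    ContinuousWithinAt (sigma T) T t := by
  rw [ContinuousWithinAt, h, tendsto_order]
  constructor
  · intro b hb
    filter_upwards [mem_nhdsWithin_of_mem_nhds (Ioi_mem_nhds hb)] with s hs
    exact lt_of_lt_of_le hs (le_sigma hsup s)
  · intro b hb
    obtain ⟨u, hu, htu, hub⟩ := exists_mem_Ioo_of_rightDense hsup h hb
    filter_upwards [mem_nhdsWithin_of_mem_nhds (Iio_mem_nhds htu)] with s hs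
    exact (sigma_le hu hs).trans_lt hub

lemma tendsto_sigma_left (hsup : ¬ BddAbove T) {t : ℝ} (ht : t ∈ T) :
    Tendsto (sigma T) (𝓝[T ∩ Set.Iio t] t) (𝓝 t) := by
  refine tendsto_of_tendsto_of_tendsto_of_le_of_le' (tendsto_id.mono_left nhdsWithin_le_nhds)
    tendsto_const_nhds (Eventually.of_forall fun s => le_sigma hsup s) ?_
  filter_upwards [self_mem_nhdsWithin] with s hs using sigma_le ht hs.2

end Order

/-! ### Delta derivatives -/

section Deriv

variable {T : Set ℝ} {E F : Type*} [NormedAddCommGroup E] [NormedSpace ℝ E]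
  [NormedAddCommGroup F] [NormedSpace ℝ F]

/-- At a right-dense point the delta derivative is the derivative within the time scale. -/
lemma hasDeltaDerivAt_iff_of_rightDense {f : ℝ → E} {f' : E} {t : ℝ} (h : sigma T t = t) :
    HasDeltaDerivAt T f f' t ↔ HasDerivWithinAt f f' T t := by
  rw [hasDerivWithinAt_iff_isLittleO, Asymptotics.isLittleO_iff]
  unfold HasDeltaDerivAt
  rw [h]
  have key : ∀ s, ‖f t - f s - (t - s) • f'‖ = ‖f s - f t - (s - t) • f'‖ := by
    intro s
    rw [← norm_neg]; congr 1
    rw [← neg_sub s t, neg_smul]; abel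
  constructor
  · intro H ε hε
    filter_upwards [H ε hε] with s hs
    rwa [← key, Real.norm_eq_abs, abs_sub_comm]
  · intro H ε hε
    filter_upwards [H hε] with s hs
    rwa [key, abs_sub_comm]

/-- At a right-scattered point the delta derivative is a difference quotient. -/
lemma hasDeltaDerivAt_iff_of_rightScattered {f : ℝ → E} {f' : E} {t : ℝ} (ht : t ∈ T)
    (h : t < sigma T t) :
    HasDeltaDerivAt T f f' t ↔
      ContinuousWithinAt f T t ∧ f (sigma T t) = f t + (sigma T t - t) • f' := by
  have hpos : 0 < sigma T t - t := sub_pos.2 h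
  constructor
  · intro H
    have e : f (sigma T t) = f t + (sigma T t - t) • f' := by
      rw [← sub_eq_zero, ← norm_le_zero_iff]
      refine le_of_forall_pos_le_add fun ε hε => ?_
      have := (H (ε / (sigma T t - t)) (by positivity)).self_of_nhdsWithin ht
      rw [abs_of_pos hpos, div_mul_cancel₀ _ hpos.ne'] at this
      rwa [zero_add, ← sub_sub]
    refine ⟨?_, e⟩
    rw [ContinuousWithinAt, tendsto_iff_norm_sub_tendsto_zero]
    have hσ : Tendsto (fun s => |sigma T t - s|) (𝓝[T] t) (𝓝 (sigma T t - t)) := by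
      have : Tendsto (fun s => |sigma T t - s|) (𝓝 t) (𝓝 |sigma T t - t|) :=
        (by fun_prop : Continuous fun s : ℝ => |sigma T t - s|).tendsto t
      rw [abs_of_pos hpos] at this
      exact this.mono_left nhdsWithin_le_nhds
    have hd : Tendsto (fun s => ‖(t - s) • f'‖) (𝓝[T] t) (𝓝 0) := by
      have : Tendsto (fun s => ‖(t - s) • f'‖) (𝓝 t) (𝓝 ‖(t - t) • f'‖) :=
        (by fun_prop : Continuous fun s : ℝ => ‖(t - s) • f'‖).tendsto t
      rw [sub_self, zero_smul, norm_zero] at this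
      exact this.mono_left nhdsWithin_le_nhds
    rw [Metric.tendsto_nhds]
    intro ε hε
    have hc : 0 < ε / (4 * (sigma T t - t)) := by positivity
    filter_upwards [H _ hc, hσ.eventually (gt_mem_nhds (show _ < 2 * (sigma T t - t) by linarith)),
      hd.eventually (gt_mem_nhds (half_pos hε))] with s h1 h2 h3
    rw [dist_zero_right, norm_norm]
    have h4 : ε / (4 * (sigma T t - t)) * |sigma T t - s| ≤ ε / 2 := by
      calc _ ≤ ε / (4 * (sigma T t - t)) * (2 * (sigma T t - t)) := by gcongr
        _ = ε / 2 := by field_simp; norm_num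
    have e2 : f s - f t =
        -(f (sigma T t) - f s - (sigma T t - s) • f') - (t - s) • f' := by
      rw [e, show sigma T t - s = (sigma T t - t) + (t - s) by ring, add_smul]; abel
    rw [e2]
    calc _ ≤ ‖-(f (sigma T t) - f s - (sigma T t - s) • f')‖ + ‖(t - s) • f'‖ := norm_sub_le _ _
      _ < ε := by rw [norm_neg]; linarith
  · rintro ⟨hc, e⟩ ε hε
    have hlim : Tendsto (fun s => ‖f (sigma T t) - f s - (sigma T t - s) • f'‖) (𝓝[T] t) (𝓝 0) := by
      have h1 : Tendsto (fun s => ‖f (sigma T t) - f s - (sigma T t - s) • f'‖) (𝓝[T] t)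
          (𝓝 ‖f (sigma T t) - f t - (sigma T t - t) • f'‖) := by
        have h2 : Tendsto (fun s : ℝ => s) (𝓝[T] t) (𝓝 t) :=
          tendsto_id.mono_left nhdsWithin_le_nhds
        exact ((tendsto_const_nhds.sub hc).sub ((tendsto_const_nhds.sub h2).smul_const f')).norm
      rwa [e, add_sub_cancel_left, sub_self, norm_zero, ← e] at h1
    filter_upwards [hlim.eventually (gt_mem_nhds (show 0 < ε * (sigma T t - t) by positivity)),
      eventually_le_of_rightScattered h] with s h1 h2
    refine h1.le.trans ?_
    rw [abs_of_pos (by linarith)]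
    gcongr

lemma HasDeltaDerivAt.continuousWithinAt {f : ℝ → E} {f' : E} {t : ℝ} (hsup : ¬ BddAbove T)
    (ht : t ∈ T) (h : HasDeltaDerivAt T f f' t) : ContinuousWithinAt f T t := by
  rcases (le_sigma hsup t).eq_or_lt with e | e
  · exact ((hasDeltaDerivAt_iff_of_rightDense e.symm).1 h).continuousWithinAt
  · exact ((hasDeltaDerivAt_iff_of_rightScattered ht e).1 h).1

lemma HasDeltaDerivAt.apply_sigma {f : ℝ → E} {f' : E} {t : ℝ} (hsup : ¬ BddAbove T)
    (ht : t ∈ T) (h : HasDeltaDerivAt T f f' t) :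
    f (sigma T t) = f t + (sigma T t - t) • f' := by
  rcases (le_sigma hsup t).eq_or_lt with e | e
  · rw [← e]; simp
  · exact ((hasDeltaDerivAt_iff_of_rightScattered ht e).1 h).2

/-- A way to establish a delta derivative: the jump formula always, continuity, and the
derivative within the time scale at right-dense points. -/
lemma hasDeltaDerivAt_of {f : ℝ → E} {f' : E} {t : ℝ} (hsup : ¬ BddAbove T) (ht : t ∈ T)
    (h₁ : sigma T t = t → HasDerivWithinAt f f' T t) (h₂ : ContinuousWithinAt f T t)
    (h₃ : f (sigma T t) = f t + (sigma T t - t) • f') : HasDeltaDerivAt T f f' t := by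
  rcases (le_sigma hsup t).eq_or_lt with e | e
  · exact (hasDeltaDerivAt_iff_of_rightDense e.symm).2 (h₁ e.symm)
  · exact (hasDeltaDerivAt_iff_of_rightScattered ht e).2 ⟨h₂, h₃⟩

lemma hasDeltaDerivAt_const (c : E) (t : ℝ) : HasDeltaDerivAt T (fun _ => c) 0 t := by
  intro ε hε
  refine Eventually.of_forall fun s => ?_
  simp only [sub_self, smul_zero, norm_zero]
  positivity

lemma HasDeltaDerivAt.add {f g : ℝ → E} {f' g' : E} {t : ℝ} (hf : HasDeltaDerivAt T f f' t)
    (hg : HasDeltaDerivAt T g g' t) : HasDeltaDerivAt T (fun s => f s + g s) (f' + g') t := by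
  intro ε hε
  filter_upwards [hf _ (half_pos hε), hg _ (half_pos hε)] with s h1 h2
  rw [smul_add, show f (sigma T t) + g (sigma T t) - (f s + g s) -
    ((sigma T t - s) • f' + (sigma T t - s) • g') = (f (sigma T t) - f s - (sigma T t - s) • f') +
      (g (sigma T t) - g s - (sigma T t - s) • g') by abel]
  exact (norm_add_le _ _).trans (by linarith)

lemma HasDeltaDerivAt.clm_apply {f : ℝ → E} {f' : E} {t : ℝ} (L : E →L[ℝ] F)
    (hf : HasDeltaDerivAt T f f' t) : HasDeltaDerivAt T (fun s => L (f s)) (L f') t := by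
  intro ε hε
  have hL : 0 < ‖L‖ + 1 := by positivity
  filter_upwards [hf (ε / (‖L‖ + 1)) (by positivity)] with s h1
  rw [← map_smul, ← map_sub, ← map_sub]
  calc _ ≤ ‖L‖ * ‖f (sigma T t) - f s - (sigma T t - s) • f'‖ := L.le_opNorm _
    _ ≤ (‖L‖ + 1) * (ε / (‖L‖ + 1) * |sigma T t - s|) := by gcongr; linarith
    _ = _ := by field_simp

lemma HasDeltaDerivAt.neg {f : ℝ → E} {f' : E} {t : ℝ} (hf : HasDeltaDerivAt T f f' t) :
    HasDeltaDerivAt T (fun s => - f s) (- f') t :=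
  hf.clm_apply (-ContinuousLinearMap.id ℝ E)

lemma HasDeltaDerivAt.sub {f g : ℝ → E} {f' g' : E} {t : ℝ} (hf : HasDeltaDerivAt T f f' t)
    (hg : HasDeltaDerivAt T g g' t) : HasDeltaDerivAt T (fun s => f s - g s) (f' - g') t := by
  simpa only [sub_eq_add_neg] using hf.add hg.neg

lemma HasDeltaDerivAt.const_smul {f : ℝ → E} {f' : E} {t : ℝ} (c : ℝ)
    (hf : HasDeltaDerivAt T f f' t) : HasDeltaDerivAt T (fun s => c • f s) (c • f') t :=
  hf.clm_apply (c • ContinuousLinearMap.id ℝ E)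

lemma HasDeltaDerivAt.sum {ι : Type*} (u : Finset ι) {f : ι → ℝ → E} {f' : ι → E} {t : ℝ}
    (hf : ∀ i ∈ u, HasDeltaDerivAt T (f i) (f' i) t) :
    HasDeltaDerivAt T (fun s => ∑ i ∈ u, f i s) (∑ i ∈ u, f' i) t := by
  classical
  induction u using Finset.induction_on with
  | empty => simpa using hasDeltaDerivAt_const (0 : E) t
  | insert i u hi ih =>
    simp only [Finset.sum_insert hi]
    exact (hf i (Finset.mem_insert_self i u)).add
      (ih fun j hj => hf j (Finset.mem_insert_of_mem hj))

/-- The delta derivative depends only on the values on the time scale near the point, and on the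
value at the forward jump. -/
lemma HasDeltaDerivAt.congr {f g : ℝ → E} {f' : E} {t : ℝ} (hf : HasDeltaDerivAt T f f' t)
    (h : g =ᶠ[𝓝[T] t] f) (hσ : g (sigma T t) = f (sigma T t)) : HasDeltaDerivAt T g f' t := by
  intro ε hε
  filter_upwards [hf ε hε, h] with s h1 h2
  rwa [h2, hσ]

end Deriv

section Ring

variable {T : Set ℝ} {R : Type*} [NormedRing R] [NormedAlgebra ℝ R]

/-- Product rule `(fg)^Δ = f^Δ g + f^σ g^Δ`. -/
lemma HasDeltaDerivAt.mul {f g : ℝ → R} {f' g' : R} {t : ℝ} (hsup : ¬ BddAbove T) (ht : t ∈ T)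
    (hf : HasDeltaDerivAt T f f' t) (hg : HasDeltaDerivAt T g g' t) :
    HasDeltaDerivAt T (fun s => f s * g s) (f' * g t + f (sigma T t) * g') t := by
  refine hasDeltaDerivAt_of hsup ht (fun h => ?_)
    ((hf.continuousWithinAt hsup ht).mul (hg.continuousWithinAt hsup ht)) ?_
  · rw [h]
    exact ((hasDeltaDerivAt_iff_of_rightDense h).1 hf).mul
      ((hasDeltaDerivAt_iff_of_rightDense h).1 hg)
  · rw [hf.apply_sigma hsup ht, hg.apply_sigma hsup ht]
    simp only [add_mul, mul_add, smul_mul_assoc, mul_smul_comm, smul_add]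
    abel

lemma HasDeltaDerivAt.mul_const {f : ℝ → R} {f' : R} {t : ℝ}
    (hf : HasDeltaDerivAt T f f' t) (c : R) : HasDeltaDerivAt T (fun s => f s * c) (f' * c) t :=
  hf.clm_apply ((ContinuousLinearMap.mul ℝ R).flip c)

/-- Derivative of the inverse: `(f⁻¹)^Δ = - (f^σ)⁻¹ f^Δ f⁻¹`. -/
lemma HasDeltaDerivAt.ringInverse [CompleteSpace R] {f : ℝ → R} {f' : R} {t : ℝ}
    (hsup : ¬ BddAbove T) (ht : t ∈ T) (hf : HasDeltaDerivAt T f f' t) (hu : IsUnit (f t))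
    (huσ : IsUnit (f (sigma T t))) :
    HasDeltaDerivAt T (fun s => Ring.inverse (f s))
      (-(Ring.inverse (f (sigma T t)) * f' * Ring.inverse (f t))) t := by
  have hd : HasFDerivAt Ring.inverse
      (-ContinuousLinearMap.mulLeftRight ℝ R (Ring.inverse (f t)) (Ring.inverse (f t))) (f t) := by
    obtain ⟨u, hu⟩ := hu
    rw [← hu, Ring.inverse_unit]
    exact hasFDerivAt_ringInverse u
  refine hasDeltaDerivAt_of hsup ht (fun h => ?_) ?_ ?_
  · have := hd.comp_hasDerivWithinAt t ((hasDeltaDerivAt_iff_of_rightDense h).1 hf)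
    rw [h]
    simpa [Function.comp_def] using this
  · exact hd.continuousAt.comp_continuousWithinAt (hf.continuousWithinAt hsup ht)
  · have e := hf.apply_sigma hsup ht
    have e2 : (sigma T t - t) • f' = f (sigma T t) - f t := by rw [e]; abel
    rw [smul_neg, ← smul_mul_assoc, ← mul_smul_comm, e2, mul_sub, sub_mul,
      Ring.inverse_mul_cancel _ huσ, one_mul, mul_assoc, Ring.mul_inverse_cancel _ hu, mul_one]
    abel

end Ring

/-! ### The mean value inequality -/

section MeanValue

variable {T : Set ℝ} {E : Type*} [NormedAddCommGroup E] [NormedSpace ℝ E]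

/-- Mean value inequality: if `‖F^Δ‖ ≤ G^Δ` on `[a, b)`, then `‖F b - F a‖ ≤ G b - G a`. -/
theorem norm_sub_le_of_hasDeltaDerivAt (hT : IsClosed T) (hsup : ¬ BddAbove T) {F f : ℝ → E}
    {G g : ℝ → ℝ} {a b : ℝ} (ha : a ∈ T) (hb : b ∈ T) (hab : a ≤ b)
    (hF : ∀ t ∈ T, a ≤ t → t ≤ b → HasDeltaDerivAt T F (f t) t)
    (hG : ∀ t ∈ T, a ≤ t → t ≤ b → HasDeltaDerivAt T G (g t) t)
    (hfg : ∀ t ∈ T, a ≤ t → t < b → ‖f t‖ ≤ g t) : ‖F b - F a‖ ≤ G b - G a := by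
  suffices H : ∀ ε > 0, ‖F b - F a‖ ≤ G b - G a + ε * (b - a) by
    have hlim : Tendsto (fun ε : ℝ => G b - G a + ε * (b - a)) (𝓝[>] 0) (𝓝 (G b - G a)) := by
      have : Tendsto (fun ε : ℝ => G b - G a + ε * (b - a)) (𝓝 0) (𝓝 (G b - G a + 0 * (b - a))) :=
        (by fun_prop : Continuous fun ε : ℝ => G b - G a + ε * (b - a)).tendsto 0
      rw [zero_mul, add_zero] at this
      exact this.mono_left nhdsWithin_le_nhds
    exact ge_of_tendsto hlim (by filter_upwards [self_mem_nhdsWithin] with ε hε using H ε hε)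
  intro ε hε
  set p : ℝ → Prop := fun t => ‖F t - F a‖ ≤ G t - G a + ε * (t - a) with hp
  -- `c` is the supremum of the points up to which the inequality holds
  set S : Set ℝ := {t | t ∈ T ∧ a ≤ t ∧ t ≤ b ∧ p t} with hS
  have haS : a ∈ S := ⟨ha, le_rfl, hab, by simp [hp]⟩
  have hSb : BddAbove S := ⟨b, fun t ht => ht.2.2.1⟩
  have hSne : S.Nonempty := ⟨a, haS⟩
  set c := sSup S with hc
  have hcl : c ∈ closure S := csSup_mem_closure hSne hSb
  have hcT : c ∈ T := hT.closure_subset (closure_mono (fun _ h => h.1) hcl)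
  have hac : a ≤ c := le_csSup hSb haS
  have hcb : c ≤ b := csSup_le hSne fun t ht => ht.2.2.1
  have hcS : c ∈ S := by
    refine ⟨hcT, hac, hcb, ?_⟩
    have hne : (𝓝[S] c).NeBot := mem_closure_iff_nhdsWithin_neBot.1 hcl
    have hsub : 𝓝[S] c ≤ 𝓝[T] c := nhdsWithin_mono _ fun _ h => h.1
    have h1 : Tendsto (fun t => ‖F t - F a‖) (𝓝[S] c) (𝓝 ‖F c - F a‖) :=
      ((((hF c hcT hac hcb).continuousWithinAt hsup hcT).mono_left hsub).sub_const _).norm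
    have h2 : Tendsto (fun t => G t - G a + ε * (t - a)) (𝓝[S] c)
        (𝓝 (G c - G a + ε * (c - a))) := by
      refine ((((hG c hcT hac hcb).continuousWithinAt hsup hcT).mono_left hsub).sub_const _).add ?_
      exact ((by fun_prop : Continuous fun t : ℝ => ε * (t - a)).tendsto c).mono_left
        nhdsWithin_le_nhds
    refine le_of_tendsto_of_tendsto h1 h2 ?_
    filter_upwards [self_mem_nhdsWithin] with t ht using ht.2.2.2
  rcases hcb.eq_or_lt with e | hlt
  · have := hcS.2.2.2
    rw [e] at this
    exact this
  exfalso
  -- it suffices to find a later point in `S`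
  suffices ∃ s ∈ S, c < s by
    obtain ⟨s, hs, hcs⟩ := this
    exact (le_csSup hSb hs).not_gt hcs
  have hstep : ∀ s, c < s → ‖F s - F c‖ ≤ G s - G c + ε * (s - c) → p s := by
    intro s _ h
    have h0 := hcS.2.2.2
    simp only [hp] at h0 ⊢
    calc ‖F s - F a‖ = ‖(F s - F c) + (F c - F a)‖ := by congr 1; abel
      _ ≤ ‖F s - F c‖ + ‖F c - F a‖ := norm_add_le _ _
      _ ≤ _ := by linarith
  have hle := hfg c hcT hac hlt
  rcases (le_sigma hsup c).eq_or_lt with e | e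
  · -- right-dense: use the definition of the derivative with `ε / 2`
    have h1 := hF c hcT hac hcb (ε / 2) (half_pos hε)
    have h2 := hG c hcT hac hcb (ε / 2) (half_pos hε)
    rw [← e] at h1 h2
    obtain ⟨δ, hδ, hball⟩ := Metric.mem_nhdsWithin_iff.1 (h1.and h2)
    obtain ⟨s, hsT, hcs, hsm⟩ := exists_mem_Ioo_of_rightDense hsup e.symm
      (show c < min (c + δ) b by simp [hδ, hlt])
    have hs : s ∈ Metric.ball c δ ∩ T := by
      refine ⟨?_, hsT⟩
      rw [Metric.mem_ball, Real.dist_eq, abs_of_pos (by linarith)]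
      linarith [min_le_left (c + δ) b]
    obtain ⟨k1, k2⟩ := hball hs
    refine ⟨s, ⟨hsT, by linarith, by linarith [min_le_right (c + δ) b], hstep s hcs ?_⟩, hcs⟩
    rw [abs_sub_comm, abs_of_pos (sub_pos.2 hcs)] at k1 k2
    rw [Real.norm_eq_abs, smul_eq_mul] at k2
    have k3 := (abs_le.1 k2).2
    have k4 : ‖F s - F c‖ ≤ ‖F c - F s - (c - s) • f c‖ + ‖(c - s) • f c‖ := by
      rw [norm_sub_rev]
      simpa using norm_add_le (F c - F s - (c - s) • f c) ((c - s) • f c)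
    rw [norm_smul, Real.norm_eq_abs, abs_sub_comm, abs_of_pos (sub_pos.2 hcs)] at k4
    nlinarith [mul_le_mul_of_nonneg_left hle (sub_pos.2 hcs).le]
  · refine ⟨sigma T c, ⟨sigma_mem hT hsup c, hac.trans e.le, sigma_le hb hlt, hstep _ e ?_⟩, e⟩
    have hpos := sub_pos.2 e
    rw [(hF c hcT hac hcb).apply_sigma hsup hcT, (hG c hcT hac hcb).apply_sigma hsup hcT,
      add_sub_cancel_left, add_sub_cancel_left, norm_smul, Real.norm_eq_abs, abs_of_pos hpos,
      smul_eq_mul]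
    nlinarith [mul_le_mul_of_nonneg_left hle hpos.le]

/-- A function with zero delta derivative is constant. -/
theorem eq_of_hasDeltaDerivAt_zero (hT : IsClosed T) (hsup : ¬ BddAbove T) {F : ℝ → E}
    {a b : ℝ} (ha : a ∈ T) (hb : b ∈ T) (hab : a ≤ b)
    (hF : ∀ t ∈ T, a ≤ t → HasDeltaDerivAt T F 0 t) : F b = F a := by
  have := norm_sub_le_of_hasDeltaDerivAt (G := fun _ => 0) (g := fun _ => 0) (f := fun _ => 0)
    hT hsup ha hb hab (fun t ht h _ => hF t ht h) (fun t _ _ _ => hasDeltaDerivAt_const 0 t)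
    (fun _ _ _ _ => by simp)
  rw [sub_self] at this
  exact sub_eq_zero.1 (norm_le_zero_iff.1 this)

lemma IsAntideriv.sub_eq_sub (hT : IsClosed T) (hsup : ¬ BddAbove T) {F G f : ℝ → E}
    (hF : IsAntideriv T F f) (hG : IsAntideriv T G f) {a b : ℝ} (ha : a ∈ T) (hb : b ∈ T) :
    F b - F a = G b - G a := by
  have key : ∀ s ∈ T, ∀ t ∈ T, s ≤ t → F t - G t = F s - G s := fun s hs t ht hst =>
    eq_of_hasDeltaDerivAt_zero (F := fun t => F t - G t) hT hsup hs ht hst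
      fun u hu _ => by simpa using (hF u hu).sub (hG u hu)
  have : F b - G b = F a - G a := by
    rcases le_total a b with h | h
    · exact key a ha b hb h
    · exact (key b hb a ha h).symm
  rw [sub_eq_sub_iff_add_eq_add] at this ⊢
  rw [this, add_comm]

end MeanValue

/-! ### Right-dense continuous functions -/

section Rd

variable {T : Set ℝ} {E F : Type*} [NormedAddCommGroup E] [NormedAddCommGroup F]

lemma rdContinuous_of_continuousWithinAt {f : ℝ → E}
    (h : ∀ t ∈ T, ContinuousWithinAt f T t) : RdContinuous T f :=
  ⟨fun t ht _ => h t ht,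
    fun t ht => ⟨f t, (h t ht).mono_left (nhdsWithin_mono _ Set.inter_subset_left)⟩⟩

lemma RdContinuous.comp {f : ℝ → E} (hf : RdContinuous T f) {φ : E → F} (hφ : Continuous φ) :
    RdContinuous T (fun t => φ (f t)) :=
  ⟨fun t ht h => hφ.continuousAt.comp_continuousWithinAt (hf.1 t ht h),
    fun t ht => (hf.2 t ht).elim fun l hl => ⟨φ l, (hφ.tendsto l).comp hl⟩⟩

lemma RdContinuous.prodMk {f : ℝ → E} {g : ℝ → F} (hf : RdContinuous T f)
    (hg : RdContinuous T g) : RdContinuous T (fun t => (f t, g t)) := by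
  refine ⟨fun t ht h => (hf.1 t ht h).prodMk (hg.1 t ht h), fun t ht => ?_⟩
  obtain ⟨l, hl⟩ := hf.2 t ht
  obtain ⟨m, hm⟩ := hg.2 t ht
  exact ⟨(l, m), hl.prodMk_nhds hm⟩

lemma RdContinuous.mono {T' : Set ℝ} {f : ℝ → E} (hf : RdContinuous T f) (h : T' ⊆ T)
    (hσ : ∀ t ∈ T', sigma T' t = sigma T t) : RdContinuous T' f := by
  refine ⟨fun t ht e => (hf.1 t (h ht) (by rwa [← hσ t ht])).mono h, fun t ht => ?_⟩
  obtain ⟨l, hl⟩ := hf.2 t (h ht)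
  exact ⟨l, hl.mono_left (nhdsWithin_mono _ (Set.inter_subset_inter_left _ h))⟩

/-- A right-dense continuous function is bounded on bounded parts of the time scale. -/
lemma RdContinuous.exists_bound (hT : IsClosed T) (hsup : ¬ BddAbove T) {f : ℝ → E}
    (hf : RdContinuous T f) (c d : ℝ) : ∃ M, 0 ≤ M ∧ ∀ t ∈ T, c ≤ t → t ≤ d → ‖f t‖ ≤ M := by
  have hK : IsCompact (T ∩ Set.Icc c d) := isCompact_Icc.inter_left hT
  obtain ⟨M, hM⟩ : ∃ M, ∀ t ∈ T ∩ Set.Icc c d, ‖f t‖ ≤ M := by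
    refine hK.induction_on (p := fun s => ∃ M, ∀ t ∈ s, ‖f t‖ ≤ M) ⟨0, by simp⟩ ?_ ?_ ?_
    · rintro s t hst ⟨M, hM⟩
      exact ⟨M, fun u hu => hM u (hst hu)⟩
    · rintro s t ⟨M, hM⟩ ⟨N, hN⟩
      refine ⟨max M N, fun u hu => ?_⟩
      rcases hu with hu | hu
      · exact (hM u hu).trans (le_max_left _ _)
      · exact (hN u hu).trans (le_max_right _ _)
    · rintro t ⟨ht, -⟩
      suffices ∃ M, ∀ᶠ s in 𝓝[T] t, ‖f s‖ ≤ M by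
        obtain ⟨M, hM⟩ := this
        exact ⟨{s | ‖f s‖ ≤ M}, nhdsWithin_mono _ Set.inter_subset_left hM, M, fun s hs => hs⟩
      rcases (le_sigma hsup t).eq_or_lt with e | e
      · refine ⟨‖f t‖ + 1, ?_⟩
        filter_upwards [(hf.1 t ht e.symm).norm.eventually (gt_mem_nhds (lt_add_one _))] with s hs
          using hs.le
      · obtain ⟨l, hl⟩ := hf.2 t ht
        have h1 := hl.norm.eventually (gt_mem_nhds (lt_add_one ‖l‖))
        rw [eventually_nhdsWithin_iff] at h1
        refine ⟨max ‖f t‖ (‖l‖ + 1), ?_⟩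
        filter_upwards [mem_nhdsWithin_of_mem_nhds h1, self_mem_nhdsWithin,
          eventually_le_of_rightScattered e] with s h2 hs h3
        rcases h3.eq_or_lt with rfl | h3
        · exact le_max_left _ _
        · exact (h2 ⟨hs, h3⟩).le.trans (le_max_right _ _)
  exact ⟨max M 0, le_max_right _ _, fun t ht h1 h2 => (hM t ⟨ht, h1, h2⟩).trans (le_max_left _ _)⟩

end Rd

/-! ### Antiderivatives through the Lebesgue integral -/

section Ext

variable {T : Set ℝ} {E : Type*} [NormedAddCommGroup E]

/-- The last point of the time scale not after `s` (the value is `0` if there is none). -/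
noncomputable def lastPoint (T : Set ℝ) (s : ℝ) : ℝ := sSup (T ∩ Set.Iic s)

/-- The extension of a function on the time scale to the real line which is constant on the gaps
`[t, σ(t))`; its Lebesgue integral is the delta integral of the function. -/
noncomputable def stepExt (T : Set ℝ) (f : ℝ → E) (s : ℝ) : E := f (lastPoint T s)

lemma lastPoint_le {c s : ℝ} (hc : c ∈ T) (hcs : c ≤ s) : lastPoint T s ≤ s :=
  csSup_le ⟨c, hc, hcs⟩ fun _ h => h.2

lemma le_lastPoint {c s : ℝ} (hc : c ∈ T) (hcs : c ≤ s) : c ≤ lastPoint T s :=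
  le_csSup ⟨s, fun _ h => h.2⟩ ⟨hc, hcs⟩

lemma lastPoint_mem (hT : IsClosed T) {c s : ℝ} (hc : c ∈ T) (hcs : c ≤ s) : lastPoint T s ∈ T :=
  hT.closure_subset (closure_mono Set.inter_subset_left
    (csSup_mem_closure (s := T ∩ Set.Iic s) ⟨c, hc, hcs⟩ ⟨s, fun _ h => h.2⟩))

lemma lastPoint_of_mem {t : ℝ} (ht : t ∈ T) : lastPoint T t = t :=
  (lastPoint_le ht le_rfl).antisymm (le_lastPoint ht le_rfl)

lemma lastPoint_congr {s u : ℝ} (hsu : s ≤ u) (h : ∀ r ∈ T, s < r → u < r) :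
    lastPoint T u = lastPoint T s := by
  unfold lastPoint
  congr 1
  ext r
  refine and_congr_right fun hr => ⟨fun h1 => ?_, fun h1 => le_trans h1 hsu⟩
  by_contra h2
  exact (h r hr (not_le.1 h2)).not_ge h1

/-- The extension by constants is continuous from the right. -/
lemma RdContinuous.stepExt_rightContinuous (hT : IsClosed T) (hsup : ¬ BddAbove T) {f : ℝ → E}
    (hf : RdContinuous T f) (s : ℝ) : Tendsto (stepExt T f) (𝓝[>] s) (𝓝 (stepExt T f s)) := by
  by_cases hgap : ∃ d > s, ∀ r ∈ T, s < r → d ≤ r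
  · obtain ⟨d, hsd, hd⟩ := hgap
    refine tendsto_const_nhds.congr' ?_
    filter_upwards [Ioo_mem_nhdsGT hsd] with u hu
    rw [stepExt, stepExt, lastPoint_congr hu.1.le fun r hr hsr => hu.2.trans_le (hd r hr hsr)]
  · -- without a gap to the right, `s` is a right-dense point of `T`
    push Not at hgap
    have hsT : s ∈ T := by
      by_contra hs
      obtain ⟨d, hd, hd'⟩ := exists_Ico_subset_of_mem_nhds
        (hT.isOpen_compl.mem_nhds hs) (exists_gt s)
      obtain ⟨r, hr, hsr, hrd⟩ := hgap d hd
      exact hd' ⟨hsr.le, hrd⟩ hr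
    have hdense : sigma T s = s := by
      refine le_antisymm ?_ (le_sigma hsup s)
      by_contra! h
      obtain ⟨r, hr, hsr, hrd⟩ := hgap _ h
      exact (sigma_le hr hsr).not_gt hrd
    have h1 : Tendsto (lastPoint T) (𝓝[>] s) (𝓝[T] s) := by
      refine tendsto_nhdsWithin_iff.2 ⟨?_, ?_⟩
      · refine tendsto_of_tendsto_of_tendsto_of_le_of_le' tendsto_const_nhds
          (tendsto_id.mono_left nhdsWithin_le_nhds) ?_ ?_
        · filter_upwards [self_mem_nhdsWithin] with u hu using le_lastPoint hsT (le_of_lt hu)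
        · filter_upwards [self_mem_nhdsWithin] with u hu using lastPoint_le hsT (le_of_lt hu)
      · filter_upwards [self_mem_nhdsWithin] with u hu using lastPoint_mem hT hsT (le_of_lt hu)
    have h2 := (hf.1 s hsT hdense).tendsto.comp h1
    rw [stepExt, lastPoint_of_mem hsT]
    exact h2

/-- A function on the real line that is continuous from the right is measurable: it is the
pointwise limit of its values at the next points of the grids of mesh `1 / (m + 1)`. -/
lemma stronglyMeasurable_of_rightContinuous {g : ℝ → E}
    (h : ∀ s, Tendsto g (𝓝[>] s) (𝓝 (g s))) : MeasureTheory.StronglyMeasurable g := by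
  have hm : ∀ m : ℕ, MeasureTheory.StronglyMeasurable
      (fun s : ℝ => g (((⌊s * (m + 1)⌋ : ℤ) + 1 : ℝ) / (m + 1))) := by
    intro m
    have h1 : MeasureTheory.StronglyMeasurable (fun z : ℤ => g (((z : ℝ) + 1) / (m + 1))) :=
      MeasureTheory.StronglyMeasurable.of_discrete
    exact h1.comp_measurable (Int.measurable_floor.comp (measurable_id.mul_const _))
  refine stronglyMeasurable_of_tendsto atTop hm (tendsto_pi_nhds.2 fun s => ?_)
  refine (h s).comp (tendsto_nhdsWithin_iff.2 ⟨?_, Eventually.of_forall fun m => ?_⟩)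
  · have hlim : Tendsto (fun m : ℕ => s + 1 / ((m : ℝ) + 1)) atTop (𝓝 s) := by
      simpa using tendsto_const_nhds.add (tendsto_one_div_add_atTop_nhds_zero_nat (𝕜 := ℝ))
    refine tendsto_of_tendsto_of_tendsto_of_le_of_le tendsto_const_nhds hlim
      (fun m => ?_) (fun m => ?_)
    · rw [le_div_iff₀ (by positivity)]
      exact (Int.lt_floor_add_one _).le
    · have hp : (0 : ℝ) < m + 1 := by positivity
      rw [div_le_iff₀ hp, add_mul, div_mul_cancel₀ _ hp.ne']
      gcongr
      exact Int.floor_le _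
  · rw [Set.mem_Ioi, lt_div_iff₀ (by positivity)]
    exact Int.lt_floor_add_one _

lemma norm_stepExt_le (hT : IsClosed T) {f : ℝ → E} {c d M : ℝ} (hc : c ∈ T)
    (hM : ∀ t ∈ T, c ≤ t → t ≤ d → ‖f t‖ ≤ M) {s : ℝ} (h1 : c ≤ s) (h2 : s ≤ d) :
    ‖stepExt T f s‖ ≤ M :=
  hM _ (lastPoint_mem hT hc h1) (le_lastPoint hc h1) ((lastPoint_le hc h1).trans h2)

lemma RdContinuous.intervalIntegrable (hT : IsClosed T) (hsup : ¬ BddAbove T) {f : ℝ → E}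
    (hf : RdContinuous T f) {c d : ℝ} (hc : c ∈ T) (hd : d ∈ T) :
    IntervalIntegrable (stepExt T f) MeasureTheory.volume c d := by
  wlog hcd : c ≤ d generalizing c d
  · exact (this hd hc (le_of_not_ge hcd)).symm
  obtain ⟨M, -, hM⟩ := hf.exists_bound hT hsup c d
  rw [intervalIntegrable_iff_integrableOn_Ioc_of_le hcd]
  refine MeasureTheory.IntegrableOn.of_bound measure_Ioc_lt_top
    (stronglyMeasurable_of_rightContinuous
      (hf.stepExt_rightContinuous hT hsup)).aestronglyMeasurable M ?_
  filter_upwards [MeasureTheory.ae_restrict_mem measurableSet_Ioc] with s hs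
  exact norm_stepExt_le hT hc hM hs.1.le hs.2

variable [NormedSpace ℝ E] [CompleteSpace E]

/-- The Lebesgue integral of the extension by constants is a delta antiderivative. -/
theorem RdContinuous.isAntideriv_integral (hT : IsClosed T) (hsup : ¬ BddAbove T) {f : ℝ → E}
    (hf : RdContinuous T f) {a : ℝ} (ha : a ∈ T) :
    IsAntideriv T (fun t => ∫ s in a..t, stepExt T f s) f := by
  intro t ht
  have hsub : ∀ s ∈ T, ∀ u ∈ T, (∫ r in a..u, stepExt T f r) - ∫ r in a..s, stepExt T f r =
      ∫ r in s..u, stepExt T f r := fun s hs u hu =>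
    intervalIntegral.integral_interval_sub_left (hf.intervalIntegrable hT hsup ha hu)
      (hf.intervalIntegrable hT hsup ha hs)
  rcases (le_sigma hsup t).eq_or_lt with e | e
  · intro ε hε
    rw [← e]
    obtain ⟨δ, hδ, hball⟩ := Metric.mem_nhdsWithin_iff.1
      ((hf.1 t ht e.symm).eventually (Metric.ball_mem_nhds _ hε))
    filter_upwards [self_mem_nhdsWithin, mem_nhdsWithin_of_mem_nhds (Metric.ball_mem_nhds t hδ)]
      with s hs hsδ
    have hconst : (t - s) • f t = ∫ _ in s..t, f t := by simp
    rw [hsub s hs t ht, hconst, ← intervalIntegral.integral_sub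
      (hf.intervalIntegrable hT hsup hs ht) (by simp)]
    refine intervalIntegral.norm_integral_le_of_norm_le_const fun r hr => ?_
    have hmin : min s t ∈ T := by rcases min_choice s t with h | h <;> rw [h] <;> assumption
    have h1 := le_lastPoint hmin hr.1.le
    have h2 := (lastPoint_le hmin hr.1.le).trans hr.2
    have h3 : lastPoint T r ∈ Metric.ball t δ ∩ T := by
      refine ⟨?_, lastPoint_mem hT hmin hr.1.le⟩
      rw [Metric.mem_ball, Real.dist_eq] at hsδ ⊢
      have h4 := abs_lt.1 hsδ
      refine abs_lt.2 ⟨?_, ?_⟩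
      · rcases min_choice s t with h | h <;> rw [h] at h1 <;> linarith
      · rcases max_choice s t with h | h <;> rw [h] at h2 <;> linarith
    have h5 : dist (f (lastPoint T r)) (f t) < ε := hball h3
    rw [dist_eq_norm] at h5
    exact h5.le
  · refine (hasDeltaDerivAt_iff_of_rightScattered ht e).2 ⟨?_, ?_⟩
    · obtain ⟨M, hM0, hM⟩ := hf.exists_bound hT hsup (t - 1) (t + 1)
      rw [ContinuousWithinAt, tendsto_iff_norm_sub_tendsto_zero]
      have hlim : Tendsto (fun s => M * |s - t|) (𝓝[T] t) (𝓝 0) := by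
        have : Tendsto (fun s => M * |s - t|) (𝓝 t) (𝓝 (M * |t - t|)) :=
          (by fun_prop : Continuous fun s : ℝ => M * |s - t|).tendsto t
        rw [sub_self, abs_zero, mul_zero] at this
        exact this.mono_left nhdsWithin_le_nhds
      refine squeeze_zero' (Eventually.of_forall fun _ => norm_nonneg _) ?_ hlim
      filter_upwards [self_mem_nhdsWithin, mem_nhdsWithin_of_mem_nhds
        (Icc_mem_nhds (sub_one_lt t) (lt_add_one t))] with s hs hst
      rw [hsub t ht s hs]
      refine intervalIntegral.norm_integral_le_of_norm_le_const fun r hr => ?_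
      have hmin : min t s ∈ T := by rcases min_choice t s with h | h <;> rw [h] <;> assumption
      refine norm_stepExt_le hT hmin (d := t + 1) (fun u hu h1 h2 => hM u hu ?_ h2) hr.1.le ?_
      · exact le_trans (le_min (by linarith) hst.1) h1
      · exact hr.2.trans (max_le (by linarith) hst.2)
    · rw [← sub_eq_iff_eq_add', hsub t ht _ (sigma_mem hT hsup t)]
      have hconst : (sigma T t - t) • f t = ∫ _ in t..sigma T t, f t := by simp
      rw [hconst]
      refine intervalIntegral.integral_congr_ae ?_
      filter_upwards [MeasureTheory.Measure.ae_ne MeasureTheory.volume (sigma T t)] with s hs hst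
      rw [Set.uIoc_of_le e.le] at hst
      rw [stepExt, lastPoint_congr hst.1.le fun r hr htr =>
        (lt_of_le_of_ne hst.2 hs).trans_le (sigma_le hr htr), lastPoint_of_mem ht]

/-- Every right-dense continuous function has an antiderivative. -/
theorem RdContinuous.exists_isAntideriv (hT : IsClosed T) (hsup : ¬ BddAbove T) {f : ℝ → E}
    (hf : RdContinuous T f) : ∃ F, IsAntideriv T F f := by
  obtain ⟨a, ha, -⟩ := exists_mem_ge hsup 0
  exact ⟨_, hf.isAntideriv_integral hT hsup ha⟩

end Ext

section Integral

variable {T : Set ℝ} {E : Type*} [NormedAddCommGroup E] [NormedSpace ℝ E]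

lemma integral_eq_sub (hT : IsClosed T) (hsup : ¬ BddAbove T) {f F : ℝ → E}
    (hF : IsAntideriv T F f) {a b : ℝ} (ha : a ∈ T) (hb : b ∈ T) :
    integral T f a b = F b - F a := by
  have h : ∃ F : ℝ → E, IsAntideriv T F f := ⟨F, hF⟩
  rw [integral, dif_pos h]
  exact h.choose_spec.sub_eq_sub hT hsup hF ha hb

lemma Convergent.exists_tendsto (hT : IsClosed T) (hsup : ¬ BddAbove T) {f F : ℝ → E}
    (hF : IsAntideriv T F f) {a : ℝ} (ha : a ∈ T) (h : Convergent T f a) :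
    ∃ v, Tendsto F (atInfty T) (𝓝 v) := by
  obtain ⟨v, hv⟩ := h
  refine ⟨v + F a, (hv.add_const (F a)).congr' ?_⟩
  filter_upwards [eventually_mem_atInfty] with b hb
  rw [integral_eq_sub hT hsup hF ha hb, sub_add_cancel]

lemma improperIntegral_eq_sub (hT : IsClosed T) (hsup : ¬ BddAbove T) {f F : ℝ → E} {v : E}
    (hF : IsAntideriv T F f) (hv : Tendsto F (atInfty T) (𝓝 v)) {t : ℝ} (ht : t ∈ T) :
    improperIntegral T f t = v - F t := by
  have := atInfty_neBot hsup
  refine Tendsto.limUnder_eq ((hv.sub_const (F t)).congr' ?_)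
  filter_upwards [eventually_mem_atInfty] with b hb
  rw [integral_eq_sub hT hsup hF ht hb]

end Integral

/-! ### Existence of solutions of linear equations -/

section Existence

variable {T : Set ℝ} {E : Type*} [NormedAddCommGroup E] [NormedSpace ℝ E]

/-- The terms of the Peano–Baker series of `x^Δ = L(t) x`, `x(t₀) = x₀`: the iterated integrals
`x₀`, `∫_{t₀}^t L(s) x₀ Δs`, and so on. -/
noncomputable def peanoBaker (T : Set ℝ) (L : ℝ → E →L[ℝ] E) (t₀ : ℝ) (x₀ : E) : ℕ → ℝ → E
  | 0 => fun _ => x₀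
  | m + 1 => fun t => ∫ s in t₀..t, stepExt T (fun r => L r (peanoBaker T L t₀ x₀ m r)) s

lemma RdContinuous.clm_apply {L : ℝ → E →L[ℝ] E} (hL : RdContinuous T L) {x : ℝ → E}
    (hx : ∀ t ∈ T, ContinuousWithinAt x T t) : RdContinuous T (fun t => L t (x t)) :=
  (hL.prodMk (rdContinuous_of_continuousWithinAt hx)).comp
    (φ := fun p : (E →L[ℝ] E) × E => p.1 p.2) (by fun_prop)

/-- Factorial decay of the Peano–Baker terms to the right of the initial point. -/
lemma norm_peanoBaker_le (hT : IsClosed T) {L : ℝ → E →L[ℝ] E} {t₀ : ℝ} (h₀ : t₀ ∈ T) (x₀ : E)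
    {b M : ℝ} (hM0 : 0 ≤ M) (hM : ∀ t ∈ T, t₀ ≤ t → t ≤ b → ‖L t‖ ≤ M) (m : ℕ) :
    ∀ t ∈ T, t₀ ≤ t → t ≤ b →
      ‖peanoBaker T L t₀ x₀ m t‖ ≤ ‖x₀‖ * ((M * (t - t₀)) ^ m / m.factorial) := by
  induction m with
  | zero => simp [peanoBaker]
  | succ m ih =>
    intro t ht htt htb
    have hcont : Continuous fun s : ℝ => M * (‖x₀‖ * ((M * (s - t₀)) ^ m / m.factorial)) := by
      fun_prop
    have h1 : ‖peanoBaker T L t₀ x₀ (m + 1) t‖ ≤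
        ∫ s in t₀..t, M * (‖x₀‖ * ((M * (s - t₀)) ^ m / m.factorial)) := by
      refine intervalIntegral.norm_integral_le_of_norm_le htt (Eventually.of_forall fun s hs => ?_)
        (hcont.intervalIntegrable _ _)
      have k1 := le_lastPoint h₀ hs.1.le
      have k2 := lastPoint_le h₀ hs.1.le
      have k3 := lastPoint_mem hT h₀ hs.1.le
      have k4 : 0 ≤ lastPoint T s - t₀ := sub_nonneg.2 k1
      calc _ ≤ ‖L (lastPoint T s)‖ * ‖peanoBaker T L t₀ x₀ m (lastPoint T s)‖ :=
            ContinuousLinearMap.le_opNorm _ _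
        _ ≤ M * (‖x₀‖ * ((M * (lastPoint T s - t₀)) ^ m / m.factorial)) := by
            gcongr
            · exact hM _ k3 k1 (k2.trans (hs.2.trans htb))
            · exact ih _ k3 k1 (k2.trans (hs.2.trans htb))
        _ ≤ _ := by gcongr
    refine h1.trans_eq ?_
    have h2 : ∀ s : ℝ, M * (‖x₀‖ * ((M * (s - t₀)) ^ m / m.factorial)) =
        (M ^ (m + 1) * ‖x₀‖ / m.factorial) * (s - t₀) ^ m := fun s => by rw [mul_pow]; ring
    simp_rw [h2]
    rw [intervalIntegral.integral_const_mul,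
      intervalIntegral.integral_comp_sub_right (fun s => s ^ m), integral_pow, sub_self,
      Nat.factorial_succ, mul_pow]
    push_cast
    field_simp
    ring

variable [CompleteSpace E]

lemma peanoBaker_continuousWithinAt (hT : IsClosed T) (hsup : ¬ BddAbove T) {L : ℝ → E →L[ℝ] E}
    (hL : RdContinuous T L) {t₀ : ℝ} (h₀ : t₀ ∈ T) (x₀ : E) (m : ℕ) :
    ∀ t ∈ T, ContinuousWithinAt (peanoBaker T L t₀ x₀ m) T t := by
  induction m with
  | zero => exact fun t _ => continuousWithinAt_const
  | succ m ih =>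
    exact fun t ht => HasDeltaDerivAt.continuousWithinAt hsup ht
      ((hL.clm_apply ih).isAntideriv_integral hT hsup h₀ t ht)

/-- Existence for the initial value problem of a linear equation at the least point of a time
scale: the Peano–Baker series converges. -/
theorem exists_solution_of_isLeast (hT : IsClosed T) (hsup : ¬ BddAbove T) {L : ℝ → E →L[ℝ] E}
    (hL : RdContinuous T L) {t₀ : ℝ} (h₀ : IsLeast T t₀) (x₀ : E) :
    ∃ x : ℝ → E, x t₀ = x₀ ∧ ∀ t ∈ T, HasDeltaDerivAt T x (L t (x t)) t := by
  set P := peanoBaker T L t₀ x₀ with hP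
  set x : ℝ → E := fun t => ∑' m, P m t with hx
  have hbound : ∀ b, ∃ M, 0 ≤ M ∧ (∀ t ∈ T, t ≤ b → ‖L t‖ ≤ M) ∧
      ∀ m, ∀ t ∈ T, t ≤ b → ‖P m t‖ ≤ ‖x₀‖ * ((M * (b - t₀)) ^ m / m.factorial) := by
    intro b
    obtain ⟨M, hM0, hM⟩ := hL.exists_bound hT hsup t₀ b
    refine ⟨M, hM0, fun t ht => hM t ht (h₀.2 ht), fun m t ht htb => ?_⟩
    refine (norm_peanoBaker_le hT h₀.1 x₀ hM0 hM m t ht (h₀.2 ht) htb).trans ?_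
    have := sub_nonneg.2 (h₀.2 ht)
    gcongr
  have hsummable : ∀ t ∈ T, Summable fun m => P m t := by
    intro t ht
    obtain ⟨M, -, -, hM⟩ := hbound t
    exact Summable.of_norm_bounded ((Real.summable_pow_div_factorial _).mul_left ‖x₀‖)
      fun m => hM m t ht le_rfl
  have hPc := peanoBaker_continuousWithinAt hT hsup hL h₀.1 x₀
  have hxc : ∀ t ∈ T, ContinuousWithinAt x T t := by
    intro t ht
    obtain ⟨M, -, -, hM⟩ := hbound (t + 1)
    have h1 : ContinuousOn x (T ∩ Set.Iio (t + 1)) :=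
      continuousOn_tsum (fun m s hs => (hPc m s hs.1).mono Set.inter_subset_left)
        ((Real.summable_pow_div_factorial _).mul_left ‖x₀‖)
        fun m s hs => hM m s hs.1 (le_of_lt hs.2)
    exact (h1 t ⟨ht, lt_add_one t⟩).mono_of_mem_nhdsWithin
      (inter_mem self_mem_nhdsWithin (mem_nhdsWithin_of_mem_nhds (Iio_mem_nhds (lt_add_one t))))
  have hLx := hL.clm_apply hxc
  have heq : ∀ t ∈ T, x t = x₀ + ∫ s in t₀..t, stepExt T (fun r => L r (x r)) s := by
    intro t ht
    obtain ⟨M, hM0, hML, hM⟩ := hbound t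
    have h1 : HasSum (fun m => P (m + 1) t) (∫ s in t₀..t, stepExt T (fun r => L r (x r)) s) := by
      refine intervalIntegral.hasSum_integral_of_dominated_convergence
        (bound := fun m _ => M * (‖x₀‖ * ((M * (t - t₀)) ^ m / m.factorial)))
        (fun m => ((hL.clm_apply (hPc m)).intervalIntegrable hT hsup h₀.1
          ht).def'.aestronglyMeasurable) ?_ ?_ (by simp) ?_
      · refine fun m => Eventually.of_forall fun s hs => ?_
        rw [Set.uIoc_of_le (h₀.2 ht)] at hs
        have k2 := (lastPoint_le h₀.1 hs.1.le).trans hs.2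
        have k3 := lastPoint_mem hT h₀.1 hs.1.le
        refine (ContinuousLinearMap.le_opNorm _ _).trans ?_
        exact mul_le_mul (hML _ k3 k2) (hM m _ k3 k2) (norm_nonneg _) hM0
      · exact Eventually.of_forall fun s _ =>
          ((Real.summable_pow_div_factorial _).mul_left _).mul_left _
      · refine Eventually.of_forall fun s hs => ?_
        rw [Set.uIoc_of_le (h₀.2 ht)] at hs
        exact (L _).hasSum (hsummable _ (lastPoint_mem hT h₀.1 hs.1.le)).hasSum
    rw [hx]
    simp only
    rw [(hsummable t ht).tsum_eq_zero_add, h1.tsum_eq]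
    rfl
  refine ⟨x, by rw [heq _ h₀.1]; simp, fun t ht => ?_⟩
  have h2 := (hasDeltaDerivAt_const x₀ t).add (hLx.isAntideriv_integral hT hsup h₀.1 t ht)
  rw [zero_add] at h2
  refine h2.congr ?_ (heq _ (sigma_mem hT hsup t))
  filter_upwards [self_mem_nhdsWithin] with s hs using heq s hs

end Existence

/-! ### Fundamental solutions -/

section Restrict

variable {T : Set ℝ} {E : Type*} [NormedAddCommGroup E] [NormedSpace ℝ E]

lemma not_bddAbove_inter_Ici (hsup : ¬ BddAbove T) (c : ℝ) : ¬ BddAbove (T ∩ Set.Ici c) := by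
  rw [not_bddAbove_iff] at hsup ⊢
  intro b
  obtain ⟨s, hs, h⟩ := hsup (max b c)
  exact ⟨s, ⟨hs, ((le_max_right _ _).trans_lt h).le⟩, (le_max_left _ _).trans_lt h⟩

lemma sigma_inter_Ici {c t : ℝ} (h : c ≤ t) : sigma (T ∩ Set.Ici c) t = sigma T t := by
  unfold sigma
  congr 1
  ext s
  exact ⟨fun hs => ⟨hs.1.1, hs.2⟩, fun hs => ⟨⟨hs.1, (h.trans_lt hs.2).le⟩, hs.2⟩⟩

lemma isLeast_inter_Ici {c : ℝ} (hc : c ∈ T) : IsLeast (T ∩ Set.Ici c) c :=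
  ⟨⟨hc, Set.self_mem_Ici⟩, fun _ h => h.2⟩

lemma HasDeltaDerivAt.of_inter_Ici {f : ℝ → E} {f' : E} {c t : ℝ} (hct : c ≤ t)
    (hc : ∀ᶠ s in 𝓝[T] t, c ≤ s) (h : HasDeltaDerivAt (T ∩ Set.Ici c) f f' t) :
    HasDeltaDerivAt T f f' t := by
  intro ε hε
  have := h ε hε
  rw [sigma_inter_Ici hct, eventually_nhdsWithin_iff] at this
  filter_upwards [mem_nhdsWithin_of_mem_nhds this, hc, self_mem_nhdsWithin] with s h1 h2 h3
    using h1 ⟨h3, h2⟩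

lemma HasDeltaDerivAt.inter_Ici_mono {f : ℝ → E} {f' : E} {c d t : ℝ} (hcd : c ≤ d) (hdt : d ≤ t)
    (h : HasDeltaDerivAt (T ∩ Set.Ici c) f f' t) : HasDeltaDerivAt (T ∩ Set.Ici d) f f' t := by
  intro ε hε
  have := h ε hε
  rw [sigma_inter_Ici (hcd.trans hdt)] at this
  rw [sigma_inter_Ici hdt]
  exact nhdsWithin_mono _ (Set.inter_subset_inter_right _ (Set.Ici_subset_Ici.2 hcd)) this

end Restrict

section Fundamental

lemma continuousAt_ringInverse {R : Type*} [NormedRing R] [CompleteSpace R] {x : R}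
    (hx : IsUnit x) : ContinuousAt Ring.inverse x := by
  obtain ⟨u, rfl⟩ := hx
  exact NormedRing.inverse_continuousAt u

variable {T : Set ℝ} {R : Type*} [NormedRing R] [NormedAlgebra ℝ R] [CompleteSpace R]

/-- The function `(1 + μ A)⁻¹` is right-dense continuous; at a left-dense point
its limit from the left is `1`, because the graininess tends to `0` there. -/
lemma RdContinuous.inverse_one_add_graininess (hsup : ¬ BddAbove T) {A : ℝ → R}
    (hA : RdContinuous T A) (hreg : ∀ t ∈ T, IsUnit (1 + graininess T t • A t)) :
    RdContinuous T (fun t => Ring.inverse (1 + graininess T t • A t)) := by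
  refine ⟨fun t ht h => ?_, fun t ht => ?_⟩
  · have hμ : ContinuousWithinAt (graininess T) T t :=
      (continuousWithinAt_sigma hsup h).sub continuousWithinAt_id
    have h1 : ContinuousWithinAt (fun s => 1 + graininess T s • A s) T t :=
      continuousWithinAt_const.add (hμ.smul (hA.1 t ht h))
    exact ContinuousAt.comp_continuousWithinAt (f := fun s => 1 + graininess T s • A s)
      (continuousAt_ringInverse (hreg t ht)) h1
  · obtain ⟨l, hl⟩ := hA.2 t ht
    have hμ : Tendsto (graininess T) (𝓝[T ∩ Set.Iio t] t) (𝓝 0) := by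
      have := (tendsto_sigma_left hsup ht).sub
        (tendsto_id.mono_left nhdsWithin_le_nhds : Tendsto id (𝓝[T ∩ Set.Iio t] t) (𝓝 t))
      rwa [sub_self] at this
    have h1 : Tendsto (fun s => 1 + graininess T s • A s) (𝓝[T ∩ Set.Iio t] t) (𝓝 1) := by
      simpa using tendsto_const_nhds.add (hμ.smul hl)
    exact ⟨_, (continuousAt_ringInverse isUnit_one).tendsto.comp h1⟩

/-- If `Φ` is an invertible solution of `Φ^Δ = A Φ` and `X` is any solution, then `Φ⁻¹ X` is
constant. -/
lemma inverse_mul_eq_of_isSolution (hT : IsClosed T) (hsup : ¬ BddAbove T) {A Φ X : ℝ → R}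
    {a b : ℝ} (ha : a ∈ T) (hb : b ∈ T) (hab : a ≤ b)
    (hΦ : ∀ t ∈ T, a ≤ t → HasDeltaDerivAt T Φ (A t * Φ t) t)
    (hu : ∀ t ∈ T, a ≤ t → IsUnit (Φ t))
    (hX : ∀ t ∈ T, a ≤ t → HasDeltaDerivAt T X (A t * X t) t) :
    Ring.inverse (Φ b) * X b = Ring.inverse (Φ a) * X a := by
  refine eq_of_hasDeltaDerivAt_zero (F := fun t => Ring.inverse (Φ t) * X t) hT hsup ha hb hab
    fun t ht hat => ?_
  have hσ := sigma_mem hT hsup t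
  have h := ((hΦ t ht hat).ringInverse hsup ht (hu t ht hat)
    (hu _ hσ (hat.trans (le_sigma hsup t)))).mul hsup ht (hX t ht hat)
  convert h using 1
  rw [mul_assoc _ (A t * Φ t), mul_assoc (A t), Ring.mul_inverse_cancel _ (hu t ht hat), mul_one]
  noncomm_ring

variable [IsDedekindFiniteMonoid R]

/-- On a time scale with a least point there is an invertible fundamental solution: its left
inverse is the solution of the adjoint equation `Y^Δ = - Y (1 + μ A)⁻¹ A`. -/
lemma exists_fundamental_of_isLeast (hT : IsClosed T) (hsup : ¬ BddAbove T) {A : ℝ → R}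
    (hA : RdContinuous T A) (hreg : ∀ t ∈ T, IsUnit (1 + graininess T t • A t)) {t₀ : ℝ}
    (h₀ : IsLeast T t₀) :
    ∃ Φ : ℝ → R, Φ t₀ = 1 ∧ ∀ t ∈ T, HasDeltaDerivAt T Φ (A t * Φ t) t ∧ IsUnit (Φ t) := by
  set N : ℝ → R := fun t => Ring.inverse (1 + graininess T t • A t) with hN
  have hNrd : RdContinuous T N := hA.inverse_one_add_graininess hsup hreg
  obtain ⟨Φ, hΦ0, hΦ⟩ := exists_solution_of_isLeast hT hsup
    (hA.comp (ContinuousLinearMap.mul ℝ R).continuous) h₀ 1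
  obtain ⟨Y, hY0, hY⟩ := exists_solution_of_isLeast hT hsup
    ((hNrd.prodMk hA).comp (φ := fun p : R × R => (ContinuousLinearMap.mul ℝ R).flip (-(p.1 * p.2)))
      ((ContinuousLinearMap.mul ℝ R).flip.continuous.comp (by fun_prop))) h₀ 1
  simp only [ContinuousLinearMap.mul_apply', ContinuousLinearMap.flip_apply] at hΦ hY
  refine ⟨Φ, hΦ0, fun t ht => ⟨hΦ t ht, ?_⟩⟩
  suffices Y t * Φ t = 1 from IsUnit.of_mul_eq_one_right _ this
  have hconst : Y t * Φ t = Y t₀ * Φ t₀ := by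
    refine eq_of_hasDeltaDerivAt_zero (F := fun t => Y t * Φ t) hT hsup h₀.1 ht (h₀.2 ht)
      fun s hs _ => ?_
    have hσ : Y (sigma T s) = Y s * N s := by
      have h1 : N s * (1 + graininess T s • A s) = 1 := Ring.inverse_mul_cancel _ (hreg s hs)
      rw [(hY s hs).apply_sigma hsup hs]
      rw [mul_add, mul_one, ← eq_sub_iff_add_eq, mul_smul_comm] at h1
      change Y s + graininess T s • (Y s * -(N s * A s)) = _
      rw [← mul_smul_comm, smul_neg, ← sub_eq_zero]
      nth_rw 1 [← mul_one (Y s)]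
      rw [← mul_add, ← sub_eq_add_neg, ← h1, sub_self]
    convert (hY s hs).mul hsup hs (hΦ s hs) using 1
    rw [hσ]
    noncomm_ring
  rw [hconst, hY0, hΦ0, one_mul]

/-- A regressive linear equation has an invertible fundamental solution on the whole time scale.
Those issuing from different starting points are glued: they agree up to a constant right factor,
and invertibility makes it possible to continue to the left of a given point. -/
theorem exists_fundamental (hT : IsClosed T) (hsup : ¬ BddAbove T) {A : ℝ → R}
    (hA : RdContinuous T A) (hreg : ∀ t ∈ T, IsUnit (1 + graininess T t • A t)) :
    ∃ Φ : ℝ → R, ∀ t ∈ T, HasDeltaDerivAt T Φ (A t * Φ t) t ∧ IsUnit (Φ t) := by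
  have hcl : ∀ c, IsClosed (T ∩ Set.Ici c) := fun c => hT.inter isClosed_Ici
  have hex : ∀ c : ℝ, ∃ Φ : ℝ → R, c ∈ T → Φ c = 1 ∧ ∀ t ∈ T ∩ Set.Ici c,
      HasDeltaDerivAt (T ∩ Set.Ici c) Φ (A t * Φ t) t ∧ IsUnit (Φ t) := by
    intro c
    by_cases hc : c ∈ T
    · obtain ⟨Φ, h⟩ := exists_fundamental_of_isLeast (hcl c) (not_bddAbove_inter_Ici hsup c)
        (hA.mono Set.inter_subset_left fun t ht => sigma_inter_Ici ht.2)
        (fun t ht => by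
          rw [graininess, sigma_inter_Ici ht.2]
          exact hreg t ht.1) (isLeast_inter_Ici hc)
      exact ⟨Φ, fun _ => h⟩
    · exact ⟨fun _ => 0, fun h => absurd h hc⟩
  -- `U c` is the fundamental solution on `T ∩ [c, ∞)` normalised at `c`
  choose U hU using hex
  -- cocycle property
  have hcoc : ∀ c ∈ T, ∀ d ∈ T, ∀ t ∈ T, c ≤ d → d ≤ t → U c t = U d t * U c d := by
    intro c hc d hd t ht hcd hdt
    have h1 := inverse_mul_eq_of_isSolution (Φ := U d) (X := U c) (A := A) (hcl d)
      (not_bddAbove_inter_Ici hsup d) (a := d) (b := t) ⟨hd, Set.self_mem_Ici⟩ ⟨ht, hdt⟩ hdt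
      (fun s hs _ => ((hU d hd).2 s hs).1) (fun s hs _ => ((hU d hd).2 s hs).2)
      (fun s hs _ => ((hU c hc).2 s ⟨hs.1, hcd.trans hs.2⟩).1.inter_Ici_mono hcd hs.2)
    rw [(hU d hd).1, Ring.inverse_one, one_mul] at h1
    rw [← h1, Ring.mul_inverse_cancel_left _ _ ((hU d hd).2 t ⟨ht, hdt⟩).2]
  obtain ⟨a, ha, -⟩ := exists_mem_ge hsup 0
  have hmin : ∀ t ∈ T, min t a ∈ T := fun t ht => by
    rcases min_choice t a with h | h <;> rw [h] <;> assumption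
  -- normalised at `a`: the solution `U a` to the right of `a`, and `(U t a)⁻¹` to the left
  set Φ : ℝ → R := fun t => U (min t a) t * Ring.inverse (U (min t a) a) with hΦ
  have hΦeq : ∀ c ∈ T, c ≤ a → ∀ t ∈ T, c ≤ t → Φ t = U c t * Ring.inverse (U c a) := by
    intro c hc hca t ht hct
    have hp := hmin t ht
    have h1 := hcoc c hc _ hp t ht (le_min hct hca) (min_le_left _ _)
    have h2 := hcoc c hc _ hp a ha (le_min hct hca) (min_le_right _ _)
    have h3 := Ring.mul_inverse_cancel _ ((hU c hc).2 a ⟨ha, hca⟩).2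
    have h4 := ((hU _ hp).2 a ⟨ha, min_le_right t a⟩).2
    rw [h2, mul_assoc] at h3
    have h5 := congrArg (fun x => Ring.inverse (U (min t a) a) * x) h3
    simp only [Ring.inverse_mul_cancel_left _ _ h4, mul_one] at h5
    rw [hΦ]
    simp only
    rw [h1, mul_assoc, h2, h5]
  refine ⟨Φ, fun t ht => ?_⟩
  obtain ⟨c, hc, hca, hct, hev⟩ : ∃ c ∈ T, c ≤ a ∧ c ≤ t ∧ ∀ᶠ s in 𝓝[T] t, c ≤ s := by
    by_cases h : ∃ c ∈ T, c < min t a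
    · obtain ⟨c, hc, hlt⟩ := h
      refine ⟨c, hc, (hlt.trans_le (min_le_right _ _)).le, (hlt.trans_le (min_le_left _ _)).le, ?_⟩
      filter_upwards [mem_nhdsWithin_of_mem_nhds
        (Ioi_mem_nhds (hlt.trans_le (min_le_left t a)))] with s hs using le_of_lt hs
    · push Not at h
      refine ⟨_, hmin t ht, min_le_right _ _, min_le_left _ _, ?_⟩
      filter_upwards [self_mem_nhdsWithin] with s hs using h s hs
  obtain ⟨h1, h2⟩ := (hU c hc).2 t ⟨ht, hct⟩
  constructor
  · have h3 := (h1.of_inter_Ici hct hev).mul_const (Ring.inverse (U c a))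
    rw [mul_assoc, ← hΦeq c hc hca t ht hct] at h3
    refine h3.congr ?_
      (hΦeq c hc hca _ (sigma_mem hT hsup t) (hct.trans (le_sigma hsup t)))
    filter_upwards [self_mem_nhdsWithin, hev] with s hs hcs using hΦeq c hc hca s hs hcs
  · rw [hΦeq c hc hca t ht hct]
    exact h2.mul ((hU c hc).2 a ⟨ha, hca⟩).2.ringInverse

end Fundamental

/-! ### Asymptotics of linear equations -/

section Asymptotics

variable {T : Set ℝ} {R : Type*} [NormedRing R] [NormedAlgebra ℝ R] [CompleteSpace R]

/-- If the coefficient `D` is absolutely integrable, an invertible solution of `Z^Δ = D Z` has an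
invertible limit: normalised to be `1` at a late time, it stays bounded and close to `1`. -/
theorem exists_isUnit_tendsto_of_norm_le (hT : IsClosed T) (hsup : ¬ BddAbove T) {Z D : ℝ → R}
    {G g : ℝ → ℝ} {v a : ℝ} (hZ : ∀ t ∈ T, a ≤ t → HasDeltaDerivAt T Z (D t * Z t) t)
    (hu : ∀ t ∈ T, a ≤ t → IsUnit (Z t)) (hD : ∀ t ∈ T, a ≤ t → ‖D t‖ ≤ g t)
    (hG : IsAntideriv T G g) (hv : Tendsto G (atInfty T) (𝓝 v)) :
    ∃ L : R, IsUnit L ∧ Tendsto Z (atInfty T) (𝓝 L) := by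
  have := atInfty_neBot hsup
  set δ : ℝ := 1 / (4 * (‖(1 : R)‖ + 1)) with hδ
  have hδ0 : 0 < δ := by positivity
  have hδ4 : δ ≤ 1 / 4 := by
    rw [hδ]
    gcongr
    linarith [norm_nonneg (1 : R)]
  have hδ1 : 2 * ‖(1 : R)‖ * δ ≤ 1 / 2 := by
    rw [hδ, mul_one_div, div_le_iff₀ (by positivity)]
    linarith
  -- from `t₀` on, the oscillation of `G` is at most `δ`
  obtain ⟨t₀, ht₀, hat₀, hosc⟩ : ∃ t₀ ∈ T, a ≤ t₀ ∧ ∀ t ∈ T, t₀ ≤ t → G t - G t₀ ≤ δ := by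
    obtain ⟨b, hb, h⟩ := (eventually_atInfty hsup).1
      ((hv.eventually (Metric.ball_mem_nhds v (half_pos hδ0))).and (eventually_ge_atInfty a))
    refine ⟨b, hb, (h b hb le_rfl).2, fun t ht hbt => ?_⟩
    have h1 := (h b hb le_rfl).1
    have h2 := (h t ht hbt).1
    rw [Real.dist_eq, abs_lt] at h1 h2
    linarith [h1.1, h2.2]
  set V : ℝ → R := fun t => Z t * Ring.inverse (Z t₀) with hV
  have hV' : ∀ t ∈ T, t₀ ≤ t → HasDeltaDerivAt T V (D t * V t) t := by
    intro t ht h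
    have := (hZ t ht (hat₀.trans h)).mul_const (Ring.inverse (Z t₀))
    rwa [mul_assoc] at this
  have hV0 : V t₀ = 1 := Ring.mul_inverse_cancel _ (hu t₀ ht₀ hat₀)
  have hincr : ∀ M, ∀ s ∈ T, ∀ t ∈ T, t₀ ≤ s → s ≤ t →
      (∀ u ∈ T, t₀ ≤ u → u ≤ t → ‖V u‖ ≤ M) → ‖V t - V s‖ ≤ M * (G t - G s) := by
    intro M s hs t ht h₀s hst hM
    have hM0 : 0 ≤ M := (norm_nonneg _).trans (hM s hs h₀s hst)
    have := norm_sub_le_of_hasDeltaDerivAt (G := fun t => M • G t) (g := fun t => M • g t) hT hsup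
      hs ht hst (fun u hu h _ => hV' u hu (h₀s.trans h)) (fun u hu _ _ => (hG u hu).const_smul M)
      (fun u hu h1 h2 => by
        rw [smul_eq_mul, mul_comm]
        refine (norm_mul_le _ _).trans ?_
        have h3 := hD u hu (hat₀.trans (h₀s.trans h1))
        exact mul_le_mul h3 (hM u hu (h₀s.trans h1) h2.le) (norm_nonneg _)
          ((norm_nonneg _).trans h3))
    rwa [smul_eq_mul, smul_eq_mul, ← mul_sub] at this
  have hbdd : ∀ b ∈ T, t₀ ≤ b → ‖V b‖ ≤ 2 * ‖(1 : R)‖ := by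
    intro b hb h₀b
    have hcont : ContinuousOn (fun t => ‖V t‖) (T ∩ Set.Icc t₀ b) := fun t ht =>
      (((hV' t ht.1 ht.2.1).continuousWithinAt hsup ht.1).mono Set.inter_subset_left).norm
    obtain ⟨m, hm, hmax⟩ := (isCompact_Icc.inter_left hT).exists_isMaxOn
      ⟨t₀, ht₀, le_rfl, h₀b⟩ hcont
    have hmax' : ∀ u ∈ T, t₀ ≤ u → u ≤ b → ‖V u‖ ≤ ‖V m‖ := fun u hu h1 h2 => hmax ⟨hu, h1, h2⟩
    have h1 := hincr ‖V m‖ t₀ ht₀ m hm.1 le_rfl hm.2.1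
      fun u hu h1 h2 => hmax' u hu h1 (h2.trans hm.2.2)
    rw [hV0] at h1
    have h2 : ‖V m‖ * (G m - G t₀) ≤ ‖V m‖ * (1 / 4) := by
      gcongr
      exact (hosc m hm.1 hm.2.1).trans hδ4
    have h3 : ‖V m‖ ≤ ‖V m - 1‖ + ‖(1 : R)‖ := by simpa using norm_add_le (V m - 1) 1
    linarith [hmax' b hb h₀b le_rfl, norm_nonneg (1 : R)]
  have hincr' : ∀ s ∈ T, ∀ t ∈ T, t₀ ≤ s → s ≤ t → ‖V t - V s‖ ≤ 2 * ‖(1 : R)‖ * (G t - G s) :=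
    fun s hs t ht h1 h2 => hincr _ s hs t ht h1 h2 fun u hu h _ => hbdd u hu h
  have hcauchy : Cauchy (map V (atInfty T)) := by
    refine cauchy_map_iff.2 ⟨this, tendsto_uniformity_iff_dist_tendsto_zero.2 ?_⟩
    have hGc := tendsto_uniformity_iff_dist_tendsto_zero.1 (cauchy_map_iff.1 hv.cauchy_map).2
    have hGc' := hGc.const_mul (2 * ‖(1 : R)‖)
    rw [mul_zero] at hGc'
    refine squeeze_zero' (Eventually.of_forall fun _ => dist_nonneg) ?_ hGc'
    have hev := eventually_mem_atInfty (T := T) |>.and (eventually_ge_atInfty t₀)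
    filter_upwards [hev.prod_mk hev] with p hp
    obtain ⟨⟨h1, h2⟩, h3, h4⟩ := hp
    simp only [dist_eq_norm]
    rcases le_total p.1 p.2 with h | h
    · rw [norm_sub_rev, norm_sub_rev (G p.1)]
      refine (hincr' _ h1 _ h3 h2 h).trans ?_
      gcongr
      exact le_abs_self _
    · refine (hincr' _ h3 _ h1 h4 h).trans ?_
      gcongr
      exact le_abs_self _
  obtain ⟨L, hL⟩ := cauchy_map_iff_exists_tendsto.1 hcauchy
  have hL1 : ‖1 - L‖ ≤ 1 / 2 := by
    refine le_of_tendsto (tendsto_const_nhds.sub hL).norm ?_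
    filter_upwards [eventually_mem_atInfty, eventually_ge_atInfty t₀] with t ht h
    rw [norm_sub_rev, ← hV0]
    refine (hincr' _ ht₀ _ ht le_rfl h).trans (le_trans ?_ hδ1)
    gcongr
    exact hosc t ht h
  have hLu : IsUnit L := by
    have := isUnit_one_sub_of_norm_lt_one (hL1.trans_lt (by norm_num))
    rwa [sub_sub_cancel] at this
  refine ⟨L * Z t₀, hLu.mul (hu t₀ ht₀ hat₀), (hL.mul_const (Z t₀)).congr fun t => ?_⟩
  rw [hV]
  simp only
  rw [Ring.inverse_mul_cancel_right _ _ (hu t₀ ht₀ hat₀)]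

/-- If `P → 1` solves `P^Δ = A P` up to an absolutely integrable error `B`, then every invertible
solution of `Φ^Δ = A Φ` has an invertible limit: `Z = P⁻¹ Φ` satisfies `Z^Δ = - (P^σ)⁻¹ B Z`. -/
theorem exists_isUnit_tendsto_of_approx (hT : IsClosed T) (hsup : ¬ BddAbove T)
    {A P B Φ : ℝ → R} {G : ℝ → ℝ} {v : ℝ}
    (hP : ∀ t ∈ T, HasDeltaDerivAt T P (A t * P t + B t) t)
    (hP1 : Tendsto P (atInfty T) (𝓝 1)) (hG : IsAntideriv T G fun t => ‖B t‖)
    (hv : Tendsto G (atInfty T) (𝓝 v))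
    (hΦ : ∀ t ∈ T, HasDeltaDerivAt T Φ (A t * Φ t) t ∧ IsUnit (Φ t)) :
    ∃ L : R, IsUnit L ∧ Tendsto Φ (atInfty T) (𝓝 L) := by
  have hinv : Tendsto (fun t => Ring.inverse (P t)) (atInfty T) (𝓝 1) := by
    have := (continuousAt_ringInverse (isUnit_one (M := R))).tendsto.comp hP1
    rwa [Ring.inverse_one] at this
  have hunit : ∀ᶠ t in atInfty T, IsUnit (P t) := hP1.eventually (Units.isOpen.mem_nhds isUnit_one)
  obtain ⟨a, ha, h⟩ := (eventually_atInfty hsup).1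
    (hunit.and (hinv.norm.eventually (gt_mem_nhds (lt_add_one _))))
  have hσ : ∀ t, a ≤ t → a ≤ sigma T t := fun t ht => ht.trans (le_sigma hsup t)
  obtain ⟨L, hLu, hL⟩ := exists_isUnit_tendsto_of_norm_le hT hsup
    (Z := fun t => Ring.inverse (P t) * Φ t) (D := fun t => -(Ring.inverse (P (sigma T t)) * B t))
    (G := fun t => (‖(1 : R)‖ + 1) • G t) (g := fun t => (‖(1 : R)‖ + 1) • ‖B t‖) (a := a)
    (v := (‖(1 : R)‖ + 1) • v)
    (fun t ht hat => by
      have hu := (h t ht hat).1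
      have huσ := (h _ (sigma_mem hT hsup t) (hσ t hat)).1
      convert ((hP t ht).ringInverse hsup ht hu huσ).mul hsup ht (hΦ t ht).1 using 1
      rw [mul_add, add_mul, ← mul_assoc _ (A t) (P t), Ring.mul_inverse_cancel_right _ _ hu]
      noncomm_ring)
    (fun t ht hat => (h t ht hat).1.ringInverse.mul (hΦ t ht).2)
    (fun t ht hat => by
      rw [norm_neg, smul_eq_mul]
      refine (norm_mul_le _ _).trans ?_
      gcongr
      exact (h _ (sigma_mem hT hsup t) (hσ t hat)).2.le)
    (fun t ht => (hG t ht).const_smul _) (hv.const_smul _)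
  refine ⟨L, hLu, ?_⟩
  have hlim := hP1.mul hL
  rw [one_mul] at hlim
  refine hlim.congr' ?_
  filter_upwards [eventually_mem_atInfty, eventually_ge_atInfty a] with t ht hat
  rw [Ring.mul_inverse_cancel_left _ _ (h t ht hat).1]

end Asymptotics

/-! ### Iterated improper integrals -/

section Iterated

variable {T : Set ℝ} {E : Type*} [NormedAddCommGroup E] [NormedSpace ℝ E] [CompleteSpace E]

/-- The tail `∫_t^∞ f` of a convergent integral has derivative `-f` and tends to `0`. -/
lemma Convergent.improperIntegral_spec (hT : IsClosed T) (hsup : ¬ BddAbove T) {f : ℝ → E}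
    (hf : RdContinuous T f) {a : ℝ} (ha : a ∈ T) (h : Convergent T f a) :
    (∀ t ∈ T, HasDeltaDerivAt T (improperIntegral T f) (-f t) t) ∧
      Tendsto (improperIntegral T f) (atInfty T) (𝓝 0) := by
  obtain ⟨F, hF⟩ := hf.exists_isAntideriv hT hsup
  obtain ⟨v, hv⟩ := h.exists_tendsto hT hsup hF ha
  have heq : ∀ t ∈ T, improperIntegral T f t = v - F t := fun t ht =>
    improperIntegral_eq_sub hT hsup hF hv ht
  constructor
  · intro t ht
    have h1 := (hasDeltaDerivAt_const v t).sub (hF t ht)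
    rw [zero_sub] at h1
    refine h1.congr ?_ (heq _ (sigma_mem hT hsup t))
    filter_upwards [self_mem_nhdsWithin] with s hs using heq s hs
  · have h1 := (tendsto_const_nhds (x := v)).sub hv
    rw [sub_self] at h1
    refine h1.congr' ?_
    filter_upwards [eventually_mem_atInfty] with t ht using (heq t ht).symm

variable {R : Type*} [NormedRing R] [NormedAlgebra ℝ R] [CompleteSpace R]

/-- The alternating sum `1 - ∫_t^∞ A + ∫_t^∞ A ∫^∞ A - ⋯` of the iterated integrals of orders up
to `k` solves `P^Δ = A P` up to the error `∓ B k`, and tends to `1`. -/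
theorem exists_approx_solution (hT : IsClosed T) (hsup : ¬ BddAbove T) {A : ℝ → R}
    (hA : RdContinuous T A) {B : ℕ → ℝ → R} (hB0 : B 0 = A)
    (hBs : ∀ j, B (j + 1) = fun t => A t * improperIntegral T (B j) t) {a : ℝ} (ha : a ∈ T)
    {k : ℕ} (hconv : ∀ j < k, Convergent T (B j) a) :
    RdContinuous T (B k) ∧ ∃ P : ℝ → R,
      (∀ t ∈ T, HasDeltaDerivAt T P (A t * P t + (-1 : ℝ) ^ (k + 1) • B k t) t) ∧
      Tendsto P (atInfty T) (𝓝 1) := by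
  set C : ℕ → ℝ → R := fun j => j.casesOn (fun _ => 1) fun i => improperIntegral T (B i) with hC
  have hBC : ∀ j, B j = fun t => A t * C j t := by
    rintro (_ | j)
    · simp [hB0, hC]
    · exact hBs j
  have hrd : ∀ j ≤ k, RdContinuous T (B j) := by
    intro j
    induction j with
    | zero => intro _; rwa [hB0]
    | succ j ih =>
      intro hj
      have h1 := (hconv j hj).improperIntegral_spec hT hsup (ih (Nat.le_of_succ_le hj)) ha
      rw [hBs]
      exact (hA.prodMk (rdContinuous_of_continuousWithinAt
        fun t ht => (h1.1 t ht).continuousWithinAt hsup ht)).comp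
          (φ := fun p : R × R => p.1 * p.2) (by fun_prop)
  have hspec := fun j (hj : j < k) => (hconv j hj).improperIntegral_spec hT hsup (hrd j hj.le) ha
  refine ⟨hrd k le_rfl, fun t => ∑ j ∈ Finset.range (k + 1), (-1 : ℝ) ^ j • C j t, ?_, ?_⟩
  · intro t ht
    have h1 : HasDeltaDerivAt T
        (fun t => ∑ j ∈ Finset.range k, (-1 : ℝ) ^ (j + 1) • C (j + 1) t + (-1 : ℝ) ^ 0 • C 0 t)
        (∑ j ∈ Finset.range k, (-1 : ℝ) ^ (j + 1) • (-B j t) + 0) t :=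
      (HasDeltaDerivAt.sum _ fun j hj =>
        ((hspec j (Finset.mem_range.1 hj)).1 t ht).const_smul _).add (hasDeltaDerivAt_const _ t)
    simp_rw [Finset.sum_range_succ']
    convert h1 using 1
    rw [← Finset.sum_range_succ' (fun j => (-1 : ℝ) ^ j • C j t), Finset.sum_range_succ, hBC k,
      mul_add, Finset.mul_sum, mul_smul_comm, pow_succ, mul_neg_one, neg_smul, add_neg_cancel_right,
      add_zero]
    refine Finset.sum_congr rfl fun j _ => ?_
    rw [hBC j, mul_smul_comm, pow_succ, mul_neg_one, neg_smul, smul_neg, neg_neg]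
  · simp_rw [Finset.sum_range_succ']
    have h1 : Tendsto
        (fun t => ∑ j ∈ Finset.range k, (-1 : ℝ) ^ (j + 1) • C (j + 1) t + (-1 : ℝ) ^ 0 • C 0 t)
        (atInfty T) (𝓝 (∑ j ∈ Finset.range k, (-1 : ℝ) ^ (j + 1) • (0 : R) + (-1 : ℝ) ^ 0 • 1)) :=
      (tendsto_finsetSum _ fun j hj =>
        (hspec j (Finset.mem_range.1 hj)).2.const_smul _).add tendsto_const_nhds
    simpa using h1

end Iterated

end TimeScale

/-! ### Matrix systems -/

attribute [local instance] Matrix.linftyOpNormedRing Matrix.linftyOpNormedAlgebra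

namespace TimeScale

variable {T : Set ℝ} {n : ℕ}

/-- An invertible fundamental matrix with an invertible limit gives class (S). -/
lemma isClassS_of_tendsto_fundamental (hT : IsClosed T) (hsup : ¬ BddAbove T)
    {A Φ : ℝ → Matrix (Fin n) (Fin n) ℝ}
    (hΦ : ∀ t ∈ T, HasDeltaDerivAt T Φ (A t * Φ t) t ∧ IsUnit (Φ t))
    {L : Matrix (Fin n) (Fin n) ℝ} (hLu : IsUnit L) (hL : Tendsto Φ (atInfty T) (𝓝 L)) :
    IsClassS T A := by
  have : CompleteSpace (Matrix (Fin n) (Fin n) ℝ) := FiniteDimensional.complete ℝ _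
  constructor
  · intro x hx
    -- the matrix all of whose columns are `x`
    let J : (Fin n → ℝ) →ₗ[ℝ] Matrix (Fin n) (Fin n) ℝ :=
      { toFun := fun v => Matrix.of fun i _ => v i
        map_add' := fun _ _ => rfl
        map_smul' := fun _ _ => rfl }
    have hJ : ∀ t ∈ T, HasDeltaDerivAt T (fun s => J (x s)) (A t * J (x t)) t := by
      intro t ht
      have h1 := (hx t ht).clm_apply (LinearMap.toContinuousLinearMap J)
      have h2 : J (A t *ᵥ x t) = A t * J (x t) := by
        ext i j
        rfl
      rw [← h2]
      exact h1
    obtain ⟨a, ha, -⟩ := exists_mem_ge hsup 0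
    have hlim := hL.mul_const (Ring.inverse (Φ a) * J (x a))
    refine ⟨fun i => (L * (Ring.inverse (Φ a) * J (x a))) i i, tendsto_pi_nhds.2 fun i => ?_⟩
    have hentry : Continuous fun M : Matrix (Fin n) (Fin n) ℝ => M i i :=
      continuous_id.matrix_elem i i
    refine ((hentry.tendsto _).comp hlim).congr' ?_
    filter_upwards [eventually_mem_atInfty, eventually_ge_atInfty a] with t ht hat
    have h3 := inverse_mul_eq_of_isSolution (A := A) (Φ := Φ) (X := fun s => J (x s)) hT hsup ha ht
      hat (fun s hs _ => (hΦ s hs).1) (fun s hs _ => (hΦ s hs).2) (fun s hs _ => hJ s hs)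
    rw [Function.comp_apply, ← h3, Ring.mul_inverse_cancel_left _ _ (hΦ t ht).2]
    rfl
  · intro v
    let K : Matrix (Fin n) (Fin n) ℝ →ₗ[ℝ] (Fin n → ℝ) :=
      { toFun := fun M => M *ᵥ (Ring.inverse L *ᵥ v)
        map_add' := fun M N => Matrix.add_mulVec M N _
        map_smul' := fun c M => Matrix.smul_mulVec c M _ }
    refine ⟨fun t => K (Φ t), fun t ht => ?_, ?_⟩
    · have h1 := (hΦ t ht).1.clm_apply (LinearMap.toContinuousLinearMap K)
      have h2 : K (A t * Φ t) = A t *ᵥ K (Φ t) := by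
        change (A t * Φ t) *ᵥ (Ring.inverse L *ᵥ v) = A t *ᵥ (Φ t *ᵥ (Ring.inverse L *ᵥ v))
        rw [Matrix.mulVec_mulVec (Ring.inverse L *ᵥ v)]
      rw [← h2]
      exact h1
    · have h1 := ((LinearMap.toContinuousLinearMap K).continuous.tendsto L).comp hL
      have h2 : K L = v := by
        change L *ᵥ (Ring.inverse L *ᵥ v) = v
        rw [Matrix.mulVec_mulVec, Ring.mul_inverse_cancel _ hLu, Matrix.one_mulVec]
      rw [← h2]
      exact h1

end TimeScale

theorem mainTheorem3 (T : Set ℝ) (hT : IsClosed T) (hsup : ¬ BddAbove T)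
    {n : ℕ} (A : ℝ → Matrix (Fin n) (Fin n) ℝ)
    (hrd : TimeScale.RdContinuous T A) (hreg : TimeScale.Regressive T A)
    (a : ℝ) (ha : a ∈ T) (k : ℕ) (hk : 1 ≤ k)
    (hconv : ∀ j < k, TimeScale.Convergent T (TimeScale.iterIntegrand T A j) a)
    (habs : TimeScale.AbsConvergent T (TimeScale.iterIntegrand T A k) a) :
    TimeScale.IsClassS T A := by
  have : CompleteSpace (Matrix (Fin n) (Fin n) ℝ) := FiniteDimensional.complete ℝ _
  obtain ⟨Φ, hΦ⟩ := TimeScale.exists_fundamental hT hsup hrd hreg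
  obtain ⟨hrdk, P, hP, hP1⟩ := TimeScale.exists_approx_solution hT hsup hrd
    (B := TimeScale.iterIntegrand T A) rfl (fun _ => rfl) ha hconv
  obtain ⟨G, hG⟩ := (hrdk.comp continuous_norm).exists_isAntideriv hT hsup
  obtain ⟨v, hv⟩ := habs.exists_tendsto hT hsup hG ha
  obtain ⟨L, hLu, hL⟩ := TimeScale.exists_isUnit_tendsto_of_approx hT hsup hP hP1
    (G := G) (by simpa [norm_smul] using hG) hv hΦ
  exact TimeScale.isClassS_of_tendsto_fundamental hT hsup hΦ hLu hL
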